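/- Let $\mathcal R(s)=\int_{0\swarrow1}\frac{x^{-s}e^{\pi i x^2}}{e^{\pi i x}-e^{-\pi i x}}\,dx$ be Riemann's auxiliary function, where $x^{-s}$ is the principal power and the path is a line of direction $e^{-3\pi i/4}$ (from upper right to lower left) crossing the real axis between $0$ and $1$. For $s\in\mathbb C$ with $-\pi<\arg s<\pi$, $s\neq0$, put $$\xi=\sqrt{\frac{s}{2\pi i}}\ \text{ with } -\tfrac{3\pi}{4}<\arg\xi<\tfrac{\pi}{4},\qquad \ell=\lfloor\Re\xi-\Im\xi\rfloor\ \ (\ge0),\qquad q=2\xi-2\ell-1,\qquad \mu=\frac{\Re q+\Im q}{\sqrt2}.$$ For $k\ge0$ define $P_k(z)$ by the expansion $$\exp\Bigl\{-\frac{i}{8\tau^2}\log(1+2i\tau z)-\frac{z}{4\tau}+\frac{i z^2}{4}\Bigr\}=\sum_{k=0}^\infty P_k(z)\tau^k\qquad(|2\tau z|<1),$$ (the singularity at $\tau=0$ being removable) and $$D_k(q)=\Bigl(-\frac{1}{4\sqrt\pi}\Bigr)^k\int_{0\swarrow}\frac{e^{\frac{\pi i}{2}(v-q)^2}}{2\cos\frac{\pi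 v}{2}}\,P_k\bigl(i\sqrt\pi\,(v-q)\bigr)\,dv,$$ where $0\swarrow$ is the line through $0$ with direction $e^{-3\pi i/4}$. Theorem. Let $0<\theta<\pi$ and let $K\ge1$ be an integer. There is a constant $C=C(K,\theta)$ such that for every $s$ in $$\Delta=\{s\in\mathbb C:\ -\pi+\theta\le\arg s\le\pi-\theta,\ |s|\ge2\pi\}$$ we have $$\mathcal R(s)=\sum_{n=1}^{\ell}n^{-s}+\frac{(-1)^\ell}{2i}\,\xi^{-s}e^{\pi i\xi^2}\Bigl\{\sum_{k=0}^K\frac{D_k(q)}{\xi^k}+E\Bigr\},\qquad |E|\le C\,e^{-\frac{\pi}{2\sqrt2}|\mu|}\,|\xi|^{-K-1},$$ where $\xi^{-s}=\exp(-s\log\xi)$ with the principal logarithm. -/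

import Mathlib

namespace RiemannAux

open Complex

noncomputable section

/-- The direction `e^{-3πi/4}` of the lines of integration (from upper right to lower left). -/
def dir : ℂ := exp (-(3 * Real.pi / 4 : ℝ) * I)

/-- The integral of `f` along the oriented straight line through `a` with direction
`e^{-3πi/4}`, parametrized by `x = a + u e^{-3πi/4}` with `u` running from `-∞` to `+∞`. -/
def lineIntegral (a : ℂ) (f : ℂ → ℂ) : ℂ :=
  ∫ u : ℝ, f (a + u * dir) * dir

/-- Riemann's auxiliary function
`R(s) = ∫_{0↙1} x^{-s} e^{πix²} / (e^{πix} - e^{-πix}) dx`, where `x^{-s}` is the principal power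
and the path is a line of direction `e^{-3πi/4}` that crosses the real axis between `0` and `1`
(by Cauchy's theorem the crossing point is immaterial; we take `1/2`). -/
def R (s : ℂ) : ℂ :=
  lineIntegral (1 / 2) fun x =>
    x ^ (-s) * exp (Real.pi * I * x ^ 2) / (exp (Real.pi * I * x) - exp (-(Real.pi * I * x)))

/-- The closed region `-π + θ ≤ arg s ≤ π - θ`, `|s| ≥ 2π`. -/
def Delta (θ : ℝ) : Set ℂ :=
  {s | -Real.pi + θ ≤ arg s ∧ arg s ≤ Real.pi - θ ∧ 2 * Real.pi ≤ ‖s‖}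

/-- `ξ = √(s / 2πi)`, the square root with `-3π/4 < arg ξ < π/4` (for `-π < arg s < π`);
see `xi_sq` and `arg_xi_mem`. -/
def xi (s : ℂ) : ℂ :=
  Real.sqrt (‖s‖ / (2 * Real.pi)) * exp ((arg s / 2 - Real.pi / 4 : ℝ) * I)

/-- `ℓ = ⌊Re ξ - Im ξ⌋`; the number `Re ξ - Im ξ` is nonnegative, see `xi_re_sub_im_nonneg`. -/
def ell (s : ℂ) : ℕ := ⌊(xi s).re - (xi s).im⌋₊

/-- `q = 2ξ - 2ℓ - 1`. -/
def q (s : ℂ) : ℂ := 2 * xi s - 2 * ell s - 1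

/-- `μ(q) = (Re q + Im q) / √2`. -/
def mu (q : ℂ) : ℝ := (q.re + q.im) / Real.sqrt 2

/-- `g(τ, z) = exp(-(i / 8τ²) log(1 + 2iτz) - z / 4τ + i z² / 4)`. The singularity at `τ = 0` is
removable, with value `1`. -/
def g (τ z : ℂ) : ℂ :=
  if τ = 0 then 1
  else exp (-(I / (8 * τ ^ 2)) * log (1 + 2 * I * τ * z) - z / (4 * τ) + I * z ^ 2 / 4)

/-- The Taylor coefficients in `g(τ, z) = ∑ P_k(z) τ^k`, `|2τz| < 1`. -/
def P (k : ℕ) (z : ℂ) : ℂ := iteratedDeriv k (fun τ => g τ z) 0 / (k.factorial : ℂ)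

/-- `D_k(q) = (-1 / 4√π)^k ∫_{0↙} e^{(πi/2)(v-q)²} / (2 cos(πv/2)) P_k(i√π (v-q)) dv`, the path
being the line of direction `e^{-3πi/4}` through the origin. -/
def D (k : ℕ) (q : ℂ) : ℂ :=
  (-1 / (4 * (Real.sqrt Real.pi : ℂ))) ^ k *
    lineIntegral 0 fun v =>
      exp (Real.pi * I / 2 * (v - q) ^ 2) / (2 * cos (Real.pi * v / 2)) *
        P k (I * (Real.sqrt Real.pi : ℂ) * (v - q))

theorem xi_sq (s : ℂ) : xi s ^ 2 = s / (2 * Real.pi * I) := by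
  have h1 : ((Real.sqrt (‖s‖ / (2 * Real.pi)) : ℝ) : ℂ) ^ 2 = ‖s‖ / (2 * Real.pi) := by
    rw [← ofReal_pow, Real.sq_sqrt (by positivity)]
    push_cast
    rfl
  have h2 : exp ((arg s / 2 - Real.pi / 4 : ℝ) * I) ^ 2 = exp (arg s * I) * -I := by
    rw [← exp_neg_pi_div_two_mul_I, ← exp_add, ← exp_nat_mul]
    congr 1
    push_cast
    ring
  have hpi : (Real.pi : ℂ) ≠ 0 := ofReal_ne_zero.mpr Real.pi_ne_zero
  rw [xi, mul_pow, h1, h2]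
  conv_rhs => rw [← norm_mul_exp_arg_mul_I s]
  field_simp
  simp

theorem arg_xi {s : ℂ} (hs : s ≠ 0) : arg (xi s) = arg s / 2 - Real.pi / 4 := by
  have h0 : 0 < Real.sqrt (‖s‖ / (2 * Real.pi)) :=
    Real.sqrt_pos.mpr (div_pos (norm_pos_iff.mpr hs) (by positivity))
  have := Real.pi_pos
  have := neg_pi_lt_arg s
  have := arg_le_pi s
  rw [xi, exp_mul_I]
  exact arg_mul_cos_add_sin_mul_I h0 ⟨by linarith, by linarith⟩

theorem arg_xi_mem {s : ℂ} (hs : s ∈ slitPlane) :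
    arg (xi s) ∈ Set.Ioo (-(3 * Real.pi / 4)) (Real.pi / 4) := by
  have h1 := neg_pi_lt_arg s
  have h2 : arg s < Real.pi := lt_of_le_of_ne (arg_le_pi s) (mem_slitPlane_iff_arg.mp hs).1
  rw [arg_xi (slitPlane_ne_zero hs)]
  constructor <;> linarith

theorem xi_re_sub_im_nonneg (s : ℂ) : 0 ≤ (xi s).re - (xi s).im := by
  have h1 := neg_pi_lt_arg s
  have h2 := arg_le_pi s
  have h3 : 0 ≤ Real.cos (arg s / 2) :=
    Real.cos_nonneg_of_mem_Icc ⟨by linarith, by linarith⟩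
  have h4 : (xi s).re - (xi s).im
      = Real.sqrt (‖s‖ / (2 * Real.pi)) * (Real.sqrt 2 * Real.cos (arg s / 2)) := by
    rw [xi, re_ofReal_mul, im_ofReal_mul, exp_ofReal_mul_I_re, exp_ofReal_mul_I_im,
      Real.cos_sub, Real.sin_sub, Real.cos_pi_div_four, Real.sin_pi_div_four]
    ring
  rw [h4]
  positivity

end

end RiemannAux

/-!
Why the expansion holds. The integrand of `R s` has simple poles at the positive integers, the
residue at `n` being `n^{-s} / 2πi`. Moving the line of integration from `1/2` to `ℓ + 1/2`
therefore produces the sum `∑ n^{-s}` (`R_eq_sum_add_lineIntegral`). No residue theorem is needed: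
`integrand s - n^{-s} integrand 0` extends holomorphically across `n`, and for `s = 0` the
difference of two consecutive line integrals is a Gaussian integral, by the quasi-periodicity
`integrand 0 (x + 1) = e^{2πix} integrand 0 x`.

On the new line put `x = ℓ + 1/2 + v/2`, so that `x - ξ = (v - q)/2`. With `τ = -1/(4√π ξ)` and
`z = i√π (v - q)` one has `2iτz = (x - ξ)/ξ`, and the integrand becomes, *exactly*, the prefactor of
the theorem times `weight q v * g τ z` (`integrand_eq`). Replacing `g τ z` by its Taylor polynomial
`∑_{k ≤ K} P_k(z) τ^k` gives the terms `D_k(q) / ξ^k`, and the error is the integral of the weight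
against the Taylor remainder.

The remainder is estimated in two ways that are combined in `norm_g_sub_sum_le`. Where
`(‖z‖ + 1) ‖τ‖` is small, Cauchy's estimates bound it by a multiple of
`(8 (‖z‖ + 1) ‖τ‖)^{K+1} e^{‖z‖²/6}`, and the Gaussian in the weight absorbs the exponential.
Elsewhere `8 (‖z‖ + 1) ‖τ‖ > 1`, and it is enough that `weight * g` itself has Gaussian decay along
the line. This is the saddle point estimate `norm_exp_mul_g_le`: with `ζ = (x - ξ)/ξ` the exponent is
`πiξ² (ζ² + 2ζ - 2 log (1 + ζ))`, and on the line through `ξ` its real part is at most a negative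
multiple of `|x - ξ|²`, with a constant depending only on `θ` (`le_re_phase`); the true line is
displaced by a bounded amount, which costs a term linear in `|x - ξ|` (`le_re_phase_displaced`).
The factor `e^{-π|μ|/(2√2)}` comes from the decay of `1 / cos (πv/2)`, since the Gaussian is centred
at `μ` in the coordinate along the line (`norm_div_two_mul_cos_le`).
-/

namespace RiemannAux

open Complex MeasureTheory

/-! ### Lines of direction `e^{-3πi/4}` -/

lemma dir_re : dir.re = -(Real.sqrt 2 / 2) := by
  rw [dir, ← ofReal_neg, exp_ofReal_mul_I_re, Real.cos_neg,
    show (3 * Real.pi / 4 : ℝ) = Real.pi - Real.pi / 4 by ring, Real.cos_pi_sub,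
    Real.cos_pi_div_four]

lemma dir_im : dir.im = -(Real.sqrt 2 / 2) := by
  rw [dir, ← ofReal_neg, exp_ofReal_mul_I_im, Real.sin_neg,
    show (3 * Real.pi / 4 : ℝ) = Real.pi - Real.pi / 4 by ring, Real.sin_pi_sub,
    Real.sin_pi_div_four]

lemma norm_dir : ‖dir‖ = 1 := by
  rw [dir, ← ofReal_neg, norm_exp_ofReal_mul_I]

lemma dir_sq : dir ^ 2 = I := by
  have h : Real.sqrt 2 * Real.sqrt 2 = 2 := Real.mul_self_sqrt (by norm_num)
  rw [sq]
  apply Complex.ext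
  · rw [mul_re, dir_re, dir_im, I_re]
    ring
  · rw [mul_im, dir_re, dir_im, I_im]
    linarith

/-- On a line of direction `dir` the exponential decays like a Gaussian, since `dir ^ 2 = I`. -/
lemma norm_exp_mul_I_mul_sq_le {lam : ℝ} (hlam : 0 ≤ lam) (c : ℂ) (u : ℝ) :
    ‖exp (lam * I * (c + u * dir) ^ 2)‖
      ≤ Real.exp (lam * (-u ^ 2 + 2 * ‖c‖ * |u| + ‖c‖ ^ 2)) := by
  rw [norm_exp]
  apply Real.exp_le_exp.mpr
  have h : (c + u * dir) ^ 2 = (c ^ 2 + 2 * c * u * dir) + ((u ^ 2 : ℝ) : ℂ) * I := by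
    rw [← dir_sq]
    push_cast
    ring
  have h1 : (lam * I * (c + u * dir) ^ 2).re = lam * (-((c + u * dir) ^ 2).im) := by
    rw [mul_assoc, re_ofReal_mul, I_mul_re]
  have h2 : ‖c ^ 2 + 2 * c * u * dir‖ ≤ ‖c‖ ^ 2 + 2 * ‖c‖ * |u| := by
    refine (norm_add_le _ _).trans (le_of_eq ?_)
    simp [norm_dir]
  have h3 := (abs_le.mp ((abs_im_le_norm _).trans h2)).1
  rw [h1, h, add_im, im_ofReal_mul, I_im]
  apply mul_le_mul_of_nonneg_left _ hlam
  linarith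

lemma integrable_exp_quadratic_abs {a : ℝ} (ha : 0 < a) (A B : ℝ) :
    Integrable fun u : ℝ => Real.exp (-a * u ^ 2 + A * |u| + B) := by
  refine ((integrable_exp_neg_mul_sq (half_pos ha)).mul_const
    (Real.exp (A ^ 2 / (2 * a) + B))).mono' (by fun_prop) (Filter.Eventually.of_forall fun u => ?_)
  rw [Real.norm_of_nonneg (Real.exp_pos _).le, ← Real.exp_add]
  apply Real.exp_le_exp.mpr
  have h : A * |u| ≤ a / 2 * u ^ 2 + A ^ 2 / (2 * a) := by
    rw [← sq_abs u]
    have h2 : a / 2 * |u| ^ 2 + A ^ 2 / (2 * a) - A * |u| = (a * |u| - A) ^ 2 / (2 * a) := by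
      field_simp
      ring
    have : 0 ≤ (a * |u| - A) ^ 2 / (2 * a) := by positivity
    linarith
  linarith

lemma tendsto_exp_quadratic_abs {a : ℝ} (ha : 0 < a) (A B : ℝ) :
    Filter.Tendsto (fun u : ℝ => Real.exp (-a * u ^ 2 + A * |u| + B)) Filter.atTop (nhds 0) := by
  apply Real.tendsto_exp_atBot.comp
  have h : Filter.Tendsto (fun u : ℝ => u * (-a * u + A) + B) Filter.atTop Filter.atBot := by
    apply Filter.tendsto_atBot_add_const_right
    apply Filter.Tendsto.atTop_mul_atBot₀ Filter.tendsto_id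
    apply Filter.tendsto_atBot_add_const_right
    exact Filter.tendsto_id.const_mul_atTop_of_neg (by linarith)
  refine h.congr' ?_
  filter_upwards [Filter.eventually_ge_atTop 0] with u hu
  rw [abs_of_nonneg hu]
  ring

/-- On the line through the origin, `1 / (2 cos (πv/2))` decays exponentially. -/
lemma exp_le_norm_two_mul_cos (u : ℝ) :
    Real.exp (Real.pi / (2 * Real.sqrt 2) * |u|) / 2
      ≤ ‖2 * cos (Real.pi * (u * dir) / 2)‖ := by
  set a : ℝ := Real.pi / (2 * Real.sqrt 2) * u with ha
  have h2 : Real.sqrt 2 * Real.sqrt 2 = 2 := Real.mul_self_sqrt (by norm_num)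
  have h2' : Real.sqrt 2 ≠ 0 := by positivity
  have hv : Real.pi * (u * dir) / 2 = -((a : ℂ) + a * I) := by
    have hd : dir = -((Real.sqrt 2 / 2 : ℝ) : ℂ) - ((Real.sqrt 2 / 2 : ℝ) : ℂ) * I := by
      apply Complex.ext <;> simp [dir_re, dir_im]
    have ha' : a = Real.pi * u * (Real.sqrt 2 / 2) / 2 := by
      rw [ha]
      field_simp
      rw [sq, h2]
    rw [hd, ha']
    push_cast
    ring
  have hcos : ‖cos (Real.pi * (u * dir) / 2)‖ ^ 2 = Real.cos a ^ 2 + Real.sinh a ^ 2 := by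
    rw [hv, cos_neg, cos_add_mul_I, ← ofReal_cos, ← ofReal_sin, ← ofReal_cosh, ← ofReal_sinh,
      ← ofReal_mul, ← ofReal_mul, Complex.sq_norm, normSq_apply]
    simp only [sub_re, sub_im, ofReal_re, ofReal_im, re_ofReal_mul, im_ofReal_mul, I_re, I_im]
    have e1 := Real.cosh_sq a
    have e2 := Real.sin_sq_add_cos_sq a
    linear_combination (Real.cos a ^ 2) * e1 + Real.sinh a ^ 2 * e2
  have hsin : Real.sin a ^ 2 ≤ Real.sinh a ^ 2 := by
    rw [← sq_abs (Real.sin a), ← sq_abs (Real.sinh a), Real.abs_sinh]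
    have h3 : |Real.sin a| ≤ |a| := Real.abs_sin_le_abs
    have h4 : |a| ≤ Real.sinh |a| := Real.self_le_sinh_iff.mpr (abs_nonneg a)
    exact pow_le_pow_left₀ (abs_nonneg _) (h3.trans h4) 2
  have hea : Real.exp (Real.pi / (2 * Real.sqrt 2) * |u|) = Real.exp |a| := by
    rw [ha, abs_mul, abs_of_pos (by positivity : 0 < Real.pi / (2 * Real.sqrt 2))]
  have hsinh : Real.sinh a ^ 2 = ((Real.exp |a| - Real.exp (-|a|)) / 2) ^ 2 := by
    rw [← Real.sinh_eq, ← Real.abs_sinh, sq_abs]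
  have hmul : Real.exp |a| * Real.exp (-|a|) = 1 := by
    rw [← Real.exp_add]
    simp
  rw [hea]
  apply abs_le_of_sq_le_sq' _ (norm_nonneg _) |>.2
  rw [norm_mul, mul_pow, hcos]
  have e2 := Real.sin_sq_add_cos_sq a
  have hpos := Real.exp_pos (-|a|)
  simp only [Complex.norm_ofNat]
  nlinarith [sq_nonneg (Real.cos a), sq_nonneg (Real.exp (-|a|))]

/-! ### Moving the line of integration past a pole -/

/-- Cauchy's theorem on a horizontal strip. -/
lemma integral_eq_integral_add_mul_I {G : ℂ → ℂ} {h T : ℝ} (hh : 0 ≤ h)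
    (hG : DifferentiableOn ℂ G {z | 0 ≤ z.im ∧ z.im ≤ h})
    (h0 : Integrable fun u : ℝ => G u) (h1 : Integrable fun u : ℝ => G (u + h * I))
    {B : ℝ → ℝ} (hB : Filter.Tendsto B Filter.atTop (nhds 0))
    (hGB : ∀ u y : ℝ, T ≤ |u| → 0 ≤ y → y ≤ h → ‖G (u + y * I)‖ ≤ B |u|) :
    ∫ u : ℝ, G u = ∫ u : ℝ, G (u + h * I) := by
  have hrect : ∀ N : ℝ, ‖(∫ u in (-N)..N, G u) - ∫ u in (-N)..N, G (u + h * I)‖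
      ≤ (‖∫ y in (0 : ℝ)..h, G (N + y * I)‖ + ‖∫ y in (0 : ℝ)..h, G (-N + y * I)‖) := by
    intro N
    have := integral_boundary_rect_eq_zero_of_differentiableOn G (-N : ℝ) (N + h * I) (by
      apply hG.mono
      intro z hz
      have hz2 := hz.2
      simp only [ofReal_im, add_im, mul_im, I_re, I_im, ofReal_re, mul_zero, mul_one, zero_add,
        add_zero] at hz2
      rw [Set.mem_preimage, Set.uIcc_of_le hh] at hz2
      exact hz2)
    simp only [ofReal_im, ofReal_re, add_im, add_re, mul_im, mul_re, I_re, I_im, mul_zero, mul_one,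
      zero_add, add_zero, sub_zero, ofReal_zero, zero_mul, smul_eq_mul] at this
    have h2 : (∫ u in (-N)..N, G u) - ∫ u in (-N)..N, G (u + h * I)
        = I * (∫ y in (0 : ℝ)..h, G ((-N : ℝ) + y * I)) - I * ∫ y in (0 : ℝ)..h, G (N + y * I) := by
      linear_combination this
    rw [h2]
    refine (norm_sub_le _ _).trans ?_
    rw [norm_mul, norm_mul, norm_I, one_mul, one_mul, add_comm]
    push_cast
    exact le_rfl
  have hside : ∀ N : ℝ, max T 0 ≤ N →
      ‖(∫ u in (-N)..N, G u) - ∫ u in (-N)..N, G (u + h * I)‖ ≤ 2 * h * B N := by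
    intro N hN
    have hN0 : 0 ≤ N := (le_max_right _ _).trans hN
    have hNT : T ≤ N := (le_max_left _ _).trans hN
    have h2 : ∀ M : ℝ, |M| = N → ‖∫ y in (0 : ℝ)..h, G (M + y * I)‖ ≤ B N * h := by
      intro M hM
      have := intervalIntegral.norm_integral_le_of_norm_le_const (a := 0) (b := h) (C := B N)
        (f := fun y : ℝ => G (M + y * I)) (by
          intro y hy
          rw [Set.uIoc_of_le hh] at hy
          have := hGB M y (by rwa [hM]) hy.1.le hy.2
          rwa [hM] at this)
      rwa [sub_zero, abs_of_nonneg hh] at this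
    have e1 := h2 N (abs_of_nonneg hN0)
    have e2 := h2 (-N) (by rw [abs_neg, abs_of_nonneg hN0])
    push_cast at e2
    linarith [hrect N]
  have hlim := (intervalIntegral_tendsto_integral h0 Filter.tendsto_neg_atTop_atBot
    Filter.tendsto_id).sub (intervalIntegral_tendsto_integral h1 Filter.tendsto_neg_atTop_atBot
    Filter.tendsto_id)
  have hz : Filter.Tendsto (fun N : ℝ => (∫ u in (-N)..N, G u) - ∫ u in (-N)..N, G (u + h * I))
      Filter.atTop (nhds 0) := by
    apply squeeze_zero_norm' (a := fun N => 2 * h * B N)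
    · filter_upwards [Filter.eventually_ge_atTop (max T 0)] with N hN using hside N hN
    · simpa using hB.const_mul (2 * h)
  exact sub_eq_zero.mp (tendsto_nhds_unique hlim hz)

/-- The integrand of `R s`. -/
noncomputable def integrand (s x : ℂ) : ℂ :=
  x ^ (-s) * exp (Real.pi * I * x ^ 2) / (exp (Real.pi * I * x) - exp (-(Real.pi * I * x)))

lemma norm_cpow_neg_le (s : ℂ) {x : ℂ} (hx : 1 / 2 ≤ x.re - x.im) :
    ‖x ^ (-s)‖ ≤ Real.exp (‖s‖ * (‖x‖ + 8)) := by
  have h1 : 1 / 4 ≤ ‖x‖ := by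
    have := abs_re_le_norm x
    have := abs_im_le_norm x
    have := le_abs_self x.re
    have := neg_abs_le x.im
    linarith
  have h0 : 0 < ‖x‖ := by linarith
  have hx0 : x ≠ 0 := norm_pos_iff.mp h0
  rw [cpow_def_of_ne_zero hx0]
  refine (norm_exp_le_exp_norm _).trans (Real.exp_le_exp.mpr ?_)
  rw [norm_mul, norm_neg, mul_comm]
  apply mul_le_mul_of_nonneg_left _ (norm_nonneg s)
  refine (norm_le_abs_re_add_abs_im _).trans ?_
  rw [log_re, log_im]
  have h2 : |Real.log ‖x‖| ≤ ‖x‖ + 4 := by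
    rw [abs_le]
    have h3 := Real.log_le_sub_one_of_pos h0
    have h4 := Real.log_le_sub_one_of_pos (inv_pos.mpr h0)
    have h5 : ‖x‖⁻¹ ≤ 4 := by
      rw [inv_le_comm₀ h0 (by norm_num)]
      linarith
    rw [Real.log_inv] at h4
    constructor <;> linarith
  have h3 := abs_arg_le_pi x
  have h4 := Real.pi_lt_four
  linarith

/-- A Gaussian bound for the integrand, off the poles. -/
lemma norm_integrand_le (s : ℂ) {c : ℂ} {M : ℝ} (hM : ‖c‖ ≤ M) (u : ℝ)
    (hx : 1 / 2 ≤ (c + u * dir).re - (c + u * dir).im)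
    (hden : 1 / 2 ≤ ‖exp (Real.pi * I * (c + u * dir)) - exp (-(Real.pi * I * (c + u * dir)))‖) :
    ‖integrand s (c + u * dir)‖
      ≤ 2 * Real.exp (-Real.pi * u ^ 2 + (‖s‖ + 2 * Real.pi * M) * |u|
          + (‖s‖ * (M + 8) + Real.pi * M ^ 2)) := by
  have h1 := norm_cpow_neg_le s hx
  have h2 := norm_exp_mul_I_mul_sq_le Real.pi_pos.le c u
  have h3 : ‖c + u * dir‖ ≤ M + |u| := by
    refine (norm_add_le _ _).trans ?_
    rw [norm_mul, norm_dir, norm_real, Real.norm_eq_abs, mul_one]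
    linarith
  rw [integrand, norm_div, norm_mul, div_le_iff₀ (by linarith)]
  calc _ ≤ Real.exp (‖s‖ * (M + |u| + 8))
        * Real.exp (Real.pi * (-u ^ 2 + 2 * M * |u| + M ^ 2)) := by
        refine mul_le_mul (h1.trans (Real.exp_le_exp.mpr ?_))
          (h2.trans (Real.exp_le_exp.mpr ?_)) (norm_nonneg _) (Real.exp_pos _).le
        · gcongr
        · have := Real.pi_pos
          gcongr
    _ = Real.exp (-Real.pi * u ^ 2 + (‖s‖ + 2 * Real.pi * M) * |u|
          + (‖s‖ * (M + 8) + Real.pi * M ^ 2)) := by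
        rw [← Real.exp_add]
        ring_nf
    _ ≤ _ := by
        have := Real.exp_pos (-Real.pi * u ^ 2 + (‖s‖ + 2 * Real.pi * M) * |u|
          + (‖s‖ * (M + 8) + Real.pi * M ^ 2))
        nlinarith

lemma denominator_eq_sin (x : ℂ) :
    exp (Real.pi * I * x) - exp (-(Real.pi * I * x)) = 2 * I * sin (Real.pi * x) := by
  rw [sin, show -(Real.pi * x) * I = -(Real.pi * I * x) by ring,
    show Real.pi * x * I = Real.pi * I * x by ring]
  linear_combination (exp (Real.pi * I * x) - exp (-(Real.pi * I * x))) * I_sq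

lemma denominator_eq_cos (n : ℕ) (v : ℂ) :
    exp (Real.pi * I * (n + 1 / 2 + v / 2)) - exp (-(Real.pi * I * (n + 1 / 2 + v / 2)))
      = (-1) ^ n * I * (2 * cos (Real.pi * v / 2)) := by
  rw [denominator_eq_sin, show Real.pi * ((n : ℂ) + 1 / 2 + v / 2)
    = Real.pi * v / 2 + Real.pi / 2 + n * Real.pi by ring,
    sin_antiperiodic.add_nat_mul_eq, sin_add_pi_div_two]
  ring

lemma half_le_norm_denominator (n : ℕ) (u : ℝ) :
    1 / 2 ≤ ‖exp (Real.pi * I * (n + 1 / 2 + u * dir))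
      - exp (-(Real.pi * I * (n + 1 / 2 + u * dir)))‖ := by
  have h := exp_le_norm_two_mul_cos (2 * u)
  have h1 : (1 : ℝ) ≤ Real.exp (Real.pi / (2 * Real.sqrt 2) * |2 * u|) :=
    Real.one_le_exp (by positivity)
  have h2 := denominator_eq_cos n ((2 * u : ℝ) * dir)
  rw [show (((2 * u : ℝ) : ℂ) * dir) / 2 = u * dir by push_cast; ring] at h2
  rw [h2, norm_mul, norm_mul, norm_pow, norm_neg, norm_one, one_pow, norm_I, one_mul, one_mul]
  linarith

lemma half_le_norm_denominator_of_im {x : ℂ} (hx : 1 ≤ |x.im|) :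
    1 / 2 ≤ ‖exp (Real.pi * I * x) - exp (-(Real.pi * I * x))‖ := by
  have h1 : ‖exp (Real.pi * I * x)‖ = Real.exp (-(Real.pi * x.im)) := by
    rw [norm_exp]
    congr 1
    rw [mul_assoc, re_ofReal_mul, I_mul_re]
    ring
  have h2 : ‖exp (-(Real.pi * I * x))‖ = Real.exp (Real.pi * x.im) := by
    rw [norm_exp]
    congr 1
    rw [mul_assoc, neg_re, re_ofReal_mul, I_mul_re]
    ring
  have h3 := abs_norm_sub_norm_le (exp (Real.pi * I * x)) (exp (-(Real.pi * I * x)))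
  refine le_trans ?_ h3
  rw [h1, h2]
  have hpi := Real.pi_gt_three
  have key : ∀ y : ℝ, 1 ≤ y → 1 / 2 ≤ Real.exp (Real.pi * y) - Real.exp (-(Real.pi * y)) := by
    intro y hy
    have := Real.add_one_le_exp (Real.pi * y)
    have : Real.exp (-(Real.pi * y)) ≤ 1 := Real.exp_le_one_iff.mpr (by nlinarith)
    nlinarith
  rcases le_abs'.mp hx with h | h
  · have := key (-x.im) (by linarith)
    rw [mul_neg, neg_neg] at this
    exact this.trans (le_abs_self _)
  · rw [abs_sub_comm]
    exact (key _ h).trans (le_abs_self _)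

lemma mem_slitPlane_of_im_lt_re {x : ℂ} (hx : 0 < x.re - x.im) : x ∈ slitPlane := by
  rw [mem_slitPlane_iff]
  by_contra hcon
  push Not at hcon
  linarith [hcon.1, hcon.2]

lemma add_mul_dir_re_sub_im (c : ℂ) (u : ℝ) :
    (c + u * dir).re - (c + u * dir).im = c.re - c.im := by
  rw [add_re, add_im, re_ofReal_mul, im_ofReal_mul, dir_re, dir_im]
  ring

lemma continuous_integrand_line (s : ℂ) (n : ℕ) :
    Continuous fun u : ℝ => integrand s (n + 1 / 2 + u * dir) := by
  rw [continuous_iff_continuousAt]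
  intro u
  have hx : (n + 1 / 2 + u * dir : ℂ) ∈ slitPlane := by
    apply mem_slitPlane_of_im_lt_re
    rw [add_mul_dir_re_sub_im]
    simp
    positivity
  have hden := half_le_norm_denominator n u
  have hden0 : exp (Real.pi * I * (n + 1 / 2 + u * dir))
      - exp (-(Real.pi * I * (n + 1 / 2 + u * dir))) ≠ 0 := norm_pos_iff.mp (by linarith)
  unfold integrand
  refine ContinuousAt.div (ContinuousAt.mul ?_ (by fun_prop)) (by fun_prop) hden0
  exact ContinuousAt.cpow (by fun_prop) continuousAt_const hx

lemma integrable_integrand_line (s : ℂ) (n : ℕ) :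
    Integrable fun u : ℝ => integrand s (n + 1 / 2 + u * dir) := by
  refine ((integrable_exp_quadratic_abs Real.pi_pos _ _).const_mul 2).mono'
    (continuous_integrand_line s n).aestronglyMeasurable
    (Filter.Eventually.of_forall fun u => norm_integrand_le s le_rfl u ?_ ?_)
  · rw [add_mul_dir_re_sub_im]
    simp
  · exact half_le_norm_denominator n u

lemma integrand_zero_add_one (x : ℂ) :
    integrand 0 (x + 1) = exp (2 * Real.pi * I * x) * integrand 0 x := by
  have h1 : exp (Real.pi * I * (x + 1) ^ 2)
      = -(exp (2 * Real.pi * I * x) * exp (Real.pi * I * x ^ 2)) := by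
    rw [← exp_add, ← neg_one_mul, ← exp_pi_mul_I, ← exp_add]
    ring_nf
  have h2 : exp (Real.pi * I * (x + 1)) - exp (-(Real.pi * I * (x + 1)))
      = -(exp (Real.pi * I * x) - exp (-(Real.pi * I * x))) := by
    rw [denominator_eq_sin, denominator_eq_sin, mul_add, mul_one, sin_add_pi]
    ring
  rw [integrand, integrand, h1, h2, neg_zero, cpow_zero, cpow_zero, one_mul, one_mul,
    neg_div_neg_eq, mul_div_assoc]

/-- For `s = 0` the two integrals differ by a Gaussian integral, because
`integrand 0 (x + 1) = e^{2πix} integrand 0 x`. -/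
lemma lineIntegral_integrand_zero_sub (n : ℕ) :
    lineIntegral (n + 1 / 2) (integrand 0) - lineIntegral ((n + 1 : ℕ) + 1 / 2) (integrand 0)
      = 1 := by
  rw [lineIntegral, lineIntegral,
    ← integral_sub ((integrable_integrand_line 0 n).mul_const _)
      ((integrable_integrand_line 0 (n + 1)).mul_const _)]
  set c : ℂ := n + 1 / 2 with hc
  have h1 : ∀ u : ℝ, integrand 0 (c + u * dir) * dir
      - integrand 0 ((n + 1 : ℕ) + 1 / 2 + u * dir) * dir
      = -dir * exp (-(Real.pi : ℂ) * u ^ 2 + Real.pi * I * (2 * c + 1) * dir * u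
          + Real.pi * I * (c ^ 2 + c)) := by
    intro u
    have h2 : ((n + 1 : ℕ) + 1 / 2 + u * dir : ℂ) = (c + u * dir) + 1 := by
      rw [hc]
      push_cast
      ring
    rw [h2, integrand_zero_add_one]
    have hden : 1 / 2 ≤ ‖exp (Real.pi * I * (c + u * dir))
      - exp (-(Real.pi * I * (c + u * dir)))‖ := half_le_norm_denominator n u
    have h3 : -(Real.pi : ℂ) * u ^ 2 + Real.pi * I * (2 * c + 1) * dir * u
          + Real.pi * I * (c ^ 2 + c)
        = Real.pi * I * (c + u * dir) ^ 2 + Real.pi * I * (c + u * dir) := by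
      have := dir_sq
      have hI := I_sq
      linear_combination (-Real.pi * I * u ^ 2) * this - (Real.pi * u ^ 2) * hI
    rw [h3, exp_add]
    set x : ℂ := c + u * dir
    have hden0 : exp (Real.pi * I * x) - exp (-(Real.pi * I * x)) ≠ 0 :=
      norm_pos_iff.mp (by linarith)
    have h4 : exp (2 * Real.pi * I * x) = exp (Real.pi * I * x) * exp (Real.pi * I * x) := by
      rw [← exp_add]
      ring_nf
    have h5 : exp (Real.pi * I * x) * exp (-(Real.pi * I * x)) = 1 := by
      rw [← exp_add, add_neg_cancel, exp_zero]
    rw [integrand, neg_zero, cpow_zero, one_mul, h4]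
    field_simp
    linear_combination (-dir) * h5
  simp_rw [h1]
  rw [integral_const_mul, integral_cexp_quadratic (by simp [Real.pi_pos])]
  have hpi : (Real.pi : ℂ) ≠ 0 := ofReal_ne_zero.mpr Real.pi_ne_zero
  rw [neg_neg, div_self hpi, one_cpow, one_mul]
  have h2 : Real.pi * I * (c ^ 2 + c) - (Real.pi * I * (2 * c + 1) * dir) ^ 2
      / (4 * -(Real.pi : ℂ)) = -(Real.pi * I) / 4 := by
    rw [mul_pow, dir_sq]
    field_simp
    linear_combination (2 * c + 1) ^ 2 * I_sq
  rw [h2, dir, neg_mul, ← exp_add]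
  have h3 : -((3 * Real.pi / 4 : ℝ) : ℂ) * I + -(Real.pi * I) / 4 = -(Real.pi * I) := by
    push_cast
    ring
  rw [h3, exp_neg, exp_pi_mul_I]
  norm_num

/-- The difference `integrand s x - m^{-s} integrand 0 x`, with its singularity at `x = m` removed:
the common factor `x - m` is cancelled from `x^{-s} - m^{-s}` and from the denominator. -/
noncomputable def regularized (s : ℂ) (m : ℕ) (x : ℂ) : ℂ :=
  dslope (fun x : ℂ => x ^ (-s)) m x * exp (Real.pi * I * x ^ 2) /
    dslope (fun x : ℂ => exp (Real.pi * I * x) - exp (-(Real.pi * I * x))) m x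

lemma denominator_natCast (m : ℕ) :
    exp (Real.pi * I * m) - exp (-(Real.pi * I * m)) = 0 := by
  rw [denominator_eq_sin, mul_comm (Real.pi : ℂ), sin_nat_mul_pi, mul_zero]

lemma regularized_of_ne (s : ℂ) {m : ℕ} {x : ℂ} (hx : x ≠ m) :
    regularized s m x = integrand s x - (m : ℂ) ^ (-s) * integrand 0 x := by
  have h0 : x - m ≠ 0 := sub_ne_zero.mpr hx
  rw [regularized, dslope_of_ne _ hx, dslope_of_ne _ hx, slope_def_field, slope_def_field,
    denominator_natCast, sub_zero, integrand, integrand, neg_zero, cpow_zero, one_mul]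
  rw [div_mul_eq_mul_div, div_div_div_cancel_right₀ h0]
  ring

lemma differentiableOn_regularized (s : ℂ) (n : ℕ) :
    DifferentiableOn ℂ (regularized s (n + 1))
      {x | (n : ℝ) + 1 / 2 ≤ x.re - x.im ∧ x.re - x.im ≤ n + 3 / 2} := by
  have hU : IsOpen {x : ℂ | 0 < x.re - x.im} :=
    isOpen_lt continuous_const (continuous_re.sub continuous_im)
  have hmem : {x : ℂ | 0 < x.re - x.im} ∈ nhds ((n + 1 : ℕ) : ℂ) := by
    apply hU.mem_nhds
    simp only [Set.mem_ofPred_eq, natCast_re, natCast_im, sub_zero]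
    positivity
  have hsub : {x : ℂ | (n : ℝ) + 1 / 2 ≤ x.re - x.im ∧ x.re - x.im ≤ n + 3 / 2}
      ⊆ {x : ℂ | 0 < x.re - x.im} := by
    intro x hx
    have h1 := hx.1
    have h2 : (0 : ℝ) ≤ n := n.cast_nonneg
    simp only [Set.mem_ofPred_eq]
    linarith
  have hnum : DifferentiableOn ℂ (dslope (fun x : ℂ => x ^ (-s)) ((n + 1 : ℕ) : ℂ))
      {x : ℂ | 0 < x.re - x.im} := by
    rw [differentiableOn_dslope hmem]
    intro x hx
    exact (DifferentiableAt.cpow differentiableAt_id (differentiableAt_const _)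
      (mem_slitPlane_of_im_lt_re hx)).differentiableWithinAt
  have hden : Differentiable ℂ (dslope (fun x : ℂ => exp (Real.pi * I * x)
      - exp (-(Real.pi * I * x))) ((n + 1 : ℕ) : ℂ)) := by
    rw [← differentiableOn_univ, differentiableOn_dslope Filter.univ_mem]
    exact Differentiable.differentiableOn (by fun_prop)
  refine ((hnum.mono hsub).mul (by fun_prop)).div hden.differentiableOn ?_
  intro x hx
  rcases eq_or_ne x ((n + 1 : ℕ) : ℂ) with h | h
  · have hd : HasDerivAt (fun x : ℂ => exp (Real.pi * I * x) - exp (-(Real.pi * I * x)))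
        (exp (Real.pi * I * x) * (Real.pi * I)
          - exp (-(Real.pi * I * x)) * (-(Real.pi * I))) x := by
      have h1 : HasDerivAt (fun x : ℂ => Real.pi * I * x) (Real.pi * I) x := by
        simpa using (hasDerivAt_id x).const_mul (Real.pi * I : ℂ)
      exact h1.cexp.sub h1.neg.cexp
    rw [h] at hd ⊢
    rw [dslope_same, hd.deriv]
    have h2 := sub_eq_zero.mp (denominator_natCast (n + 1))
    rw [← h2]
    have h3 : exp (Real.pi * I * ((n + 1 : ℕ) : ℂ)) ≠ 0 := exp_ne_zero _
    have h4 : (Real.pi : ℂ) ≠ 0 := ofReal_ne_zero.mpr Real.pi_ne_zero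
    intro h5
    have h6 : exp (Real.pi * I * ((n + 1 : ℕ) : ℂ)) * (2 * Real.pi * I) = 0 := by
      linear_combination h5
    simp [h4] at h6
  · rw [dslope_of_ne _ h, slope_def_field, denominator_natCast, sub_zero, denominator_eq_sin]
    refine div_ne_zero (mul_ne_zero (by simp) ?_) (sub_ne_zero.mpr h)
    intro h1
    obtain ⟨k, hk⟩ := sin_eq_zero_iff.mp h1
    have hpi : (Real.pi : ℂ) ≠ 0 := ofReal_ne_zero.mpr Real.pi_ne_zero
    have hxk : x = k := mul_left_cancel₀ hpi (by rw [hk, mul_comm])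
    rw [hxk] at hx h
    simp only [Set.mem_ofPred_eq, intCast_re, intCast_im, sub_zero] at hx
    have h2 : (n : ℤ) < k := by
      have : (n : ℝ) < k := by linarith [hx.1]
      exact_mod_cast this
    have h3 : k < n + 2 := by
      have : (k : ℝ) < n + 2 := by linarith [hx.2]
      exact_mod_cast this
    have h4 : k = ((n + 1 : ℕ) : ℤ) := by
      push_cast
      omega
    exact h (by rw [h4]; push_cast; rfl)

lemma lineIntegral_regularized (s : ℂ) {c : ℂ} (n m : ℕ) (hc : c = n + 1 / 2)
    (hne : ∀ u : ℝ, c + u * dir ≠ m) :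
    ∫ u : ℝ, regularized s m (c + u * dir) * dir
      = lineIntegral c (integrand s) - (m : ℂ) ^ (-s) * lineIntegral c (integrand 0) := by
  have h1 := (integrable_integrand_line s n).mul_const dir
  have h0 := (integrable_integrand_line 0 n).mul_const dir
  rw [lineIntegral, lineIntegral, ← integral_const_mul, hc, ← integral_sub h1 (h0.const_mul _)]
  refine integral_congr_ae (Filter.Eventually.of_forall fun u => ?_)
  simp only
  rw [regularized_of_ne s (by rw [← hc]; exact hne u)]
  ring

lemma integrable_regularized (s : ℂ) {c : ℂ} (n m : ℕ) (hc : c = n + 1 / 2)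
    (hne : ∀ u : ℝ, c + u * dir ≠ m) :
    Integrable fun u : ℝ => regularized s m (c + u * dir) * dir := by
  have h1 := (integrable_integrand_line s n)
  have h0 := (integrable_integrand_line 0 n)
  refine ((h1.sub (h0.const_mul ((m : ℂ) ^ (-s)))).mul_const dir).congr
    (Filter.Eventually.of_forall fun u => ?_)
  simp only [Pi.sub_apply]
  rw [regularized_of_ne s (hne u), hc]

/-- Moving the line across the pole `n + 1` contributes its residue `(n + 1)^{-s}`. -/
lemma lineIntegral_integrand_sub (s : ℂ) (n : ℕ) :
    lineIntegral (n + 1 / 2) (integrand s) - lineIntegral ((n + 1 : ℕ) + 1 / 2) (integrand s)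
      = ((n + 1 : ℕ) : ℂ) ^ (-s) := by
  obtain ⟨c, hc⟩ : ∃ c : ℂ, c = n + 1 / 2 := ⟨_, rfl⟩
  obtain ⟨c', hc'⟩ : ∃ c' : ℂ, c' = (n + 1 : ℕ) + 1 / 2 := ⟨_, rfl⟩
  obtain ⟨h, hh⟩ : ∃ h : ℝ, h = Real.sqrt 2 / 2 := ⟨_, rfl⟩
  have h2 : Real.sqrt 2 * Real.sqrt 2 = 2 := Real.mul_self_sqrt (by norm_num)
  have hh0 : 1 / 2 ≤ h := by
    rw [hh]
    nlinarith [Real.sqrt_nonneg 2]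
  have hh1 : h ≤ 1 := by
    rw [hh]
    nlinarith [Real.sqrt_nonneg 2]
  have hcre : c.re - c.im = n + 1 / 2 := by rw [hc]; simp
  have hcre' : c'.re - c'.im = n + 3 / 2 := by
    rw [hc']
    simp
    ring
  have hne : ∀ u : ℝ, c + u * dir ≠ (n + 1 : ℕ) := by
    intro u hu
    have := add_mul_dir_re_sub_im c u
    rw [hu, hcre, natCast_re, natCast_im] at this
    push_cast at this
    linarith
  have hne' : ∀ u : ℝ, c' + u * dir ≠ (n + 1 : ℕ) := by
    intro u hu
    have := add_mul_dir_re_sub_im c' u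
    rw [hu, hcre', natCast_re, natCast_im] at this
    push_cast at this
    linarith
  -- the two lines correspond to `Im z = 0` and `Im z = h`, up to a translation by `h`
  have hshift : ∀ u : ℝ, c + (u + h * I) * dir = c' + (u + h : ℝ) * dir := by
    intro u
    have h3 : (h : ℂ) * I * dir = 1 + h * dir := by
      apply Complex.ext
      · rw [mul_assoc, re_ofReal_mul, I_mul_re, add_re, re_ofReal_mul, dir_re, dir_im, hh, one_re]
        linarith
      · rw [mul_assoc, im_ofReal_mul, I_mul_im, add_im, im_ofReal_mul, dir_re, dir_im, hh, one_im]
        ring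
    rw [hc, hc']
    push_cast
    linear_combination h3
  have hmv : ∀ z : ℂ, (c + z * dir).re - (c + z * dir).im
      = n + 1 / 2 + Real.sqrt 2 * z.im := by
    intro z
    rw [← hcre, add_re, add_im, mul_re, mul_im, dir_re, dir_im]
    ring
  set G : ℂ → ℂ := fun z => regularized s (n + 1) (c + z * dir) * dir with hG
  have hdiff : DifferentiableOn ℂ G {z | 0 ≤ z.im ∧ z.im ≤ h} := by
    refine DifferentiableOn.mul_const ?_ _
    refine (differentiableOn_regularized s n).comp (t := {x : ℂ | (n : ℝ) + 1 / 2 ≤ x.re - x.im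
      ∧ x.re - x.im ≤ n + 3 / 2}) (by fun_prop) ?_
    intro z hz
    simp only [Set.mem_ofPred_eq]
    rw [hmv]
    have h3 := mul_nonneg (Real.sqrt_nonneg 2) hz.1
    have h4 := mul_le_mul_of_nonneg_left hz.2 (Real.sqrt_nonneg 2)
    rw [hh] at h4
    constructor <;> linarith
  have hI0 : Integrable fun u : ℝ => G u := integrable_regularized s n (n + 1) hc hne
  have hGshift : ∀ u : ℝ, G (u + h * I)
      = regularized s (n + 1) (c' + (u + h : ℝ) * dir) * dir := by
    intro u
    simp only [hG]
    rw [hshift]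
  have hI1 : Integrable fun u : ℝ => G (u + h * I) := by
    simp_rw [hGshift]
    exact (integrable_regularized s (n + 1) (n + 1) hc' hne').comp_add_right h
  set M : ℝ := ‖c‖ + 1
  set B : ℂ → ℝ → ℝ := fun s u => 2 * Real.exp (-Real.pi * u ^ 2 + (‖s‖ + 2 * Real.pi * M) * |u|
          + (‖s‖ * (M + 8) + Real.pi * M ^ 2)) with hB
  have hBt : ∀ s, Filter.Tendsto (B s) Filter.atTop (nhds 0) := by
    intro s
    have := (tendsto_exp_quadratic_abs Real.pi_pos (‖s‖ + 2 * Real.pi * M)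
      (‖s‖ * (M + 8) + Real.pi * M ^ 2)).const_mul 2
    rwa [mul_zero] at this
  have hBlim : Filter.Tendsto (fun u => B s u + ‖((n + 1 : ℕ) : ℂ) ^ (-s)‖ * B 0 u) Filter.atTop
      (nhds 0) := by
    simpa using (hBt s).add ((hBt 0).const_mul _)
  have hbound : ∀ u y : ℝ, 2 * (M + 1) ≤ |u| → 0 ≤ y → y ≤ h →
      ‖G (u + y * I)‖ ≤ B s |u| + ‖((n + 1 : ℕ) : ℂ) ^ (-s)‖ * B 0 |u| := by
    intro u y hu hy0 hyh
    have e1 : c + (u + y * I) * dir = (c + y * I * dir) + u * dir := by ring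
    have hcM : ‖c + y * I * dir‖ ≤ M := by
      refine (norm_add_le _ _).trans ?_
      rw [norm_mul, norm_mul, norm_dir, norm_I, norm_real, Real.norm_of_nonneg hy0]
      linarith
    have hre : 1 / 2 ≤ (c + y * I * dir + u * dir).re - (c + y * I * dir + u * dir).im := by
      rw [← e1, hmv]
      have : (u + y * I : ℂ).im = y := by simp
      rw [this]
      have := mul_nonneg (Real.sqrt_nonneg 2) hy0
      have : (0 : ℝ) ≤ n := n.cast_nonneg
      linarith
    have him : 1 ≤ |(c + y * I * dir + u * dir).im| := by
      rw [add_im, im_ofReal_mul, dir_im, ← hh]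
      have h3 := (abs_im_le_norm _).trans hcM
      have h4 : |u * -h| = |u| * h := by
        rw [abs_mul, abs_neg, abs_of_nonneg (by linarith : 0 ≤ h)]
      have h5 : |u| * (1 / 2) ≤ |u| * h := mul_le_mul_of_nonneg_left hh0 (abs_nonneg u)
      have h6 := abs_sub_abs_le_abs_add (u * -h) (c + y * I * dir).im
      rw [add_comm (u * -h)] at h6
      linarith
    have hden := half_le_norm_denominator_of_im him
    have hnem : c + y * I * dir + u * dir ≠ ((n + 1 : ℕ) : ℂ) := by
      intro h3
      rw [h3, natCast_im, abs_zero] at him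
      linarith
    have b1 := norm_integrand_le s hcM u hre hden
    have b0 := norm_integrand_le 0 hcM u hre hden
    simp only [hG]
    rw [norm_mul, norm_dir, mul_one, e1, regularized_of_ne s hnem]
    refine (norm_sub_le _ _).trans ?_
    rw [norm_mul]
    simp only [hB, sq_abs, abs_abs]
    exact add_le_add b1 (mul_le_mul_of_nonneg_left b0 (norm_nonneg _))
  have key := integral_eq_integral_add_mul_I (by linarith) hdiff hI0 hI1 hBlim hbound
  simp_rw [hGshift] at key
  rw [integral_add_right_eq_self
    (fun u : ℝ => regularized s (n + 1) (c' + u * dir) * dir) h] at key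
  simp only [hG] at key
  rw [lineIntegral_regularized s n (n + 1) hc hne,
    lineIntegral_regularized s (n + 1) (n + 1) hc' hne'] at key
  have h0 := lineIntegral_integrand_zero_sub n
  rw [← hc, ← hc'] at h0 ⊢
  linear_combination key + ((n + 1 : ℕ) : ℂ) ^ (-s) * h0

lemma R_eq_sum_add_lineIntegral (s : ℂ) (n : ℕ) :
    R s = ∑ k ∈ Finset.Icc 1 n, (k : ℂ) ^ (-s) + lineIntegral (n + 1 / 2) (integrand s) := by
  induction n with
  | zero =>
    rw [Nat.cast_zero, zero_add]
    simp only [zero_lt_one, Finset.Icc_eq_empty_of_lt, Finset.sum_empty, zero_add]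
    rfl
  | succ n ih =>
    rw [Finset.sum_Icc_succ_top (by omega), ← lineIntegral_integrand_sub s n, ih]
    ring

/-! ### The expansion of `g` in powers of `τ` -/

lemma norm_log_one_add_sub_le {ζ : ℂ} (hζ : ‖ζ‖ ≤ 1 / 2) :
    ‖log (1 + ζ) - (ζ - ζ ^ 2 / 2)‖ ≤ ‖ζ‖ ^ 3 * (2 / 3) := by
  have h := norm_log_sub_logTaylor_le 2 (z := ζ) (by linarith)
  have e : logTaylor (2 + 1) ζ = ζ - ζ ^ 2 / 2 := by
    rw [logTaylor_succ, logTaylor_succ, logTaylor_succ, logTaylor_zero]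
    simp
    ring
  rw [e] at h
  refine h.trans ?_
  have h1 : (1 - ‖ζ‖)⁻¹ ≤ 2 := by
    rw [inv_le_comm₀ (by linarith) (by norm_num)]
    linarith
  have h2 : ‖ζ‖ ^ (2 + 1) * (1 - ‖ζ‖)⁻¹ ≤ ‖ζ‖ ^ 3 * 2 :=
    mul_le_mul_of_nonneg_left h1 (by positivity)
  norm_num at h2 ⊢
  linarith

/-- The part `z/(4τ) - iz²/4` subtracted in the definition of `g` is what the two leading Taylor
terms of the logarithm produce. -/
lemma g_eq_exp {τ : ℂ} (hτ : τ ≠ 0) (z : ℂ) :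
    g τ z = exp (-(I / (8 * τ ^ 2)) *
      (log (1 + 2 * I * τ * z) - (2 * I * τ * z - (2 * I * τ * z) ^ 2 / 2))) := by
  rw [g, if_neg hτ]
  congr 1
  field_simp
  linear_combination (-8 * z * τ + 8 * I * τ ^ 2 * z ^ 2) * I_sq

lemma norm_two_mul_I_mul (τ z : ℂ) : ‖2 * I * τ * z‖ = 2 * ‖τ‖ * ‖z‖ := by
  simp

lemma norm_exponent_le {τ z : ℂ} (hτ : τ ≠ 0) (h : 2 * ‖τ‖ * ‖z‖ ≤ 1 / 2) :
    ‖-(I / (8 * τ ^ 2)) *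
      (log (1 + 2 * I * τ * z) - (2 * I * τ * z - (2 * I * τ * z) ^ 2 / 2))‖
      ≤ 2 / 3 * ‖τ‖ * ‖z‖ ^ 3 := by
  have h1 := norm_log_one_add_sub_le (ζ := 2 * I * τ * z) (by rwa [norm_two_mul_I_mul])
  rw [norm_two_mul_I_mul] at h1
  have h0 : 0 < ‖τ‖ := norm_pos_iff.mpr hτ
  have h2 : ‖-(I / (8 * τ ^ 2))‖ = 1 / (8 * ‖τ‖ ^ 2) := by simp
  rw [norm_mul, h2]
  calc _ ≤ 1 / (8 * ‖τ‖ ^ 2) * ((2 * ‖τ‖ * ‖z‖) ^ 3 * (2 / 3)) := by gcongr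
    _ = _ := by
      field_simp
      ring

lemma norm_g_le {τ z : ℂ} (h : 2 * ‖τ‖ * ‖z‖ ≤ 1 / 2) : ‖g τ z‖ ≤ Real.exp (‖z‖ ^ 2 / 6) := by
  rcases eq_or_ne τ 0 with h0 | h0
  · rw [g, if_pos h0, norm_one]
    exact Real.one_le_exp (by positivity)
  · rw [g_eq_exp h0]
    refine (norm_exp_le_exp_norm _).trans (Real.exp_le_exp.mpr ?_)
    refine (norm_exponent_le h0 h).trans ?_
    have := mul_le_mul_of_nonneg_right h (sq_nonneg ‖z‖)
    linarith

lemma continuousAt_g_zero (z : ℂ) : ContinuousAt (fun τ => g τ z) 0 := by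
  have hev : ∀ᶠ τ : ℂ in nhds 0, 2 * ‖τ‖ * ‖z‖ ≤ 1 / 2 := by
    have hc : Filter.Tendsto (fun τ : ℂ => 2 * ‖τ‖ * ‖z‖) (nhds 0) (nhds (2 * ‖(0 : ℂ)‖ * ‖z‖)) :=
      Continuous.tendsto (by fun_prop) 0
    rw [norm_zero, mul_zero, zero_mul] at hc
    exact hc.eventually_le_const (by norm_num)
  -- a logarithm of `g`, with its singularity at `0` filled in by `0`
  have hlim : Filter.Tendsto (fun τ : ℂ => if τ = 0 then 0 else -(I / (8 * τ ^ 2)) *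
      (log (1 + 2 * I * τ * z) - (2 * I * τ * z - (2 * I * τ * z) ^ 2 / 2))) (nhds 0) (nhds 0) := by
    apply squeeze_zero_norm' (a := fun τ : ℂ => 2 / 3 * ‖τ‖ * ‖z‖ ^ 3)
    · filter_upwards [hev] with τ hτ
      split_ifs with h0
      · rw [norm_zero]
        positivity
      · exact norm_exponent_le h0 hτ
    · have : Filter.Tendsto (fun τ : ℂ => 2 / 3 * ‖τ‖ * ‖z‖ ^ 3) (nhds 0)
        (nhds (2 / 3 * ‖(0 : ℂ)‖ * ‖z‖ ^ 3)) := Continuous.tendsto (by fun_prop) 0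
      simpa using this
  have h1 : (fun τ => g τ z) = fun τ : ℂ => exp (if τ = 0 then 0 else -(I / (8 * τ ^ 2)) *
      (log (1 + 2 * I * τ * z) - (2 * I * τ * z - (2 * I * τ * z) ^ 2 / 2))) := by
    funext τ
    split_ifs with h0
    · rw [g, if_pos h0, exp_zero]
    · exact g_eq_exp h0 z
  have h2 : g 0 z = exp 0 := by rw [g, if_pos rfl, exp_zero]
  have h3 := (continuous_exp.tendsto 0).comp hlim
  rw [← h2] at h3
  change Filter.Tendsto (fun τ => g τ z) (nhds 0) (nhds (g 0 z))
  rw [h1]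
  exact h3

lemma differentiableOn_g (z : ℂ) :
    DifferentiableOn ℂ (fun τ => g τ z) {τ | 2 * ‖τ‖ * ‖z‖ < 1} := by
  have hopen : IsOpen {τ : ℂ | 2 * ‖τ‖ * ‖z‖ < 1} := isOpen_lt (by fun_prop) continuous_const
  have hmem : {τ : ℂ | 2 * ‖τ‖ * ‖z‖ < 1} ∈ nhds 0 := hopen.mem_nhds (by simp)
  rw [← differentiableOn_compl_singleton_and_continuousAt_iff hmem]
  refine ⟨?_, continuousAt_g_zero z⟩
  have hd : DifferentiableOn ℂ (fun τ => exp (-(I / (8 * τ ^ 2)) * log (1 + 2 * I * τ * z)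
      - z / (4 * τ) + I * z ^ 2 / 4)) ({τ | 2 * ‖τ‖ * ‖z‖ < 1} \ {0}) := by
    intro τ hτ
    have h0 : τ ≠ 0 := hτ.2
    have hs : 1 + 2 * I * τ * z ∈ slitPlane := by
      apply mem_slitPlane_of_norm_lt_one
      rw [norm_two_mul_I_mul]
      exact hτ.1
    have h8 : 8 * τ ^ 2 ≠ 0 := mul_ne_zero (by norm_num) (pow_ne_zero 2 h0)
    have h4 : 4 * τ ≠ 0 := mul_ne_zero (by norm_num) h0
    apply DifferentiableAt.differentiableWithinAt
    have hl : DifferentiableAt ℂ (fun τ : ℂ => log (1 + 2 * I * τ * z)) τ :=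
      DifferentiableAt.clog (by fun_prop) hs
    have h5 : DifferentiableAt ℂ (fun τ : ℂ => I / (8 * τ ^ 2)) τ :=
      (differentiableAt_const _).div (by fun_prop) h8
    have h6 : DifferentiableAt ℂ (fun τ : ℂ => z / (4 * τ)) τ :=
      (differentiableAt_const _).div (by fun_prop) h4
    exact (((h5.neg.mul hl).sub h6).add_const _).cexp
  refine hd.congr fun τ hτ => ?_
  have h0 : τ ≠ 0 := hτ.2
  simp only [g, if_neg h0]

/-- On the disc of radius `1 / (4 (‖z‖ + 1))`, which is finite even for `z = 0`, the estimate
`norm_g_le` applies. -/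
lemma two_mul_radius_le (z : ℂ) {τ : ℂ} (h : ‖τ‖ ≤ 1 / (4 * (‖z‖ + 1))) :
    2 * ‖τ‖ * ‖z‖ ≤ 1 / 2 := by
  have hz := norm_nonneg z
  rw [le_div_iff₀ (by positivity)] at h
  have := norm_nonneg τ
  linarith

lemma norm_P_le (k : ℕ) (z : ℂ) :
    ‖P k z‖ ≤ Real.exp (‖z‖ ^ 2 / 6) * (4 * (‖z‖ + 1)) ^ k := by
  have hR : 0 < 1 / (4 * (‖z‖ + 1)) := by positivity
  have hd : DiffContOnCl ℂ (fun τ => g τ z) (Metric.ball 0 (1 / (4 * (‖z‖ + 1)))) := by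
    apply DifferentiableOn.diffContOnCl
    rw [closure_ball _ hR.ne']
    refine (differentiableOn_g z).mono fun τ hτ => ?_
    have := two_mul_radius_le z (mem_closedBall_zero_iff.mp hτ)
    simp only [Set.mem_ofPred_eq]
    linarith
  have h := norm_iteratedDeriv_le_of_forall_mem_sphere_norm_le k hR hd
    (C := Real.exp (‖z‖ ^ 2 / 6)) (fun τ hτ => norm_g_le
      (two_mul_radius_le z (mem_sphere_zero_iff_norm.mp hτ).le))
  have hk : (0 : ℝ) < k.factorial := by exact_mod_cast k.factorial_pos
  rw [P, norm_div, norm_natCast, div_le_iff₀ hk]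
  refine h.trans (le_of_eq ?_)
  rw [div_pow, one_pow]
  field_simp

lemma hasSum_P (z : ℂ) {τ : ℂ} (h : ‖τ‖ < 1 / (4 * (‖z‖ + 1))) :
    HasSum (fun k => P k z * τ ^ k) (g τ z) := by
  have hd : DifferentiableOn ℂ (fun τ => g τ z) (Metric.ball 0 (1 / (4 * (‖z‖ + 1)))) := by
    refine (differentiableOn_g z).mono fun τ hτ => ?_
    have := two_mul_radius_le z (mem_ball_zero_iff.mp hτ).le
    simp only [Set.mem_ofPred_eq]
    linarith
  have h1 := hasSum_taylorSeries_on_ball hd (mem_ball_zero_iff.mpr h)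
  have e : (fun k => P k z * τ ^ k) = fun k : ℕ =>
      ((k.factorial : ℂ))⁻¹ • (τ - 0) ^ k • iteratedDeriv k (fun τ => g τ z) 0 := by
    funext k
    rw [smul_eq_mul, smul_eq_mul, sub_zero, P]
    ring
  rw [e]
  exact h1

/-- Taylor's formula inside half the disc used in `norm_P_le`. -/
lemma norm_g_sub_sum_le_of_small (K : ℕ) (z : ℂ) {τ : ℂ} (h : 8 * (‖z‖ + 1) * ‖τ‖ ≤ 1) :
    ‖g τ z - ∑ k ∈ Finset.range K, P k z * τ ^ k‖
      ≤ 2 * Real.exp (‖z‖ ^ 2 / 6) * (4 * (‖z‖ + 1) * ‖τ‖) ^ K := by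
  set x := 4 * (‖z‖ + 1) * ‖τ‖ with hx
  have hx0 : 0 ≤ x := by positivity
  have hx2 : x ≤ 1 / 2 := by linarith
  have hlt : ‖τ‖ < 1 / (4 * (‖z‖ + 1)) := by
    rw [lt_div_iff₀ (by positivity)]
    linarith
  have hs := hasSum_P z hlt
  have h1 := (hasSum_nat_add_iff' K).mpr hs
  have hgeo := ((hasSum_geometric_of_lt_one hx0 (by linarith)).mul_left
    (Real.exp (‖z‖ ^ 2 / 6) * x ^ K))
  rw [← h1.tsum_eq]
  refine (tsum_of_norm_bounded hgeo fun k => ?_).trans ?_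
  · rw [norm_mul, norm_pow]
    calc _ ≤ Real.exp (‖z‖ ^ 2 / 6) * (4 * (‖z‖ + 1)) ^ (k + K) * ‖τ‖ ^ (k + K) := by
          gcongr
          exact norm_P_le _ _
      _ = Real.exp (‖z‖ ^ 2 / 6) * x ^ (k + K) := by rw [mul_assoc, ← mul_pow]
      _ = _ := by rw [pow_add, mul_assoc, mul_comm (x ^ K)]
  · have : (1 - x)⁻¹ ≤ 2 := by
      rw [inv_le_comm₀ (by linarith) (by norm_num)]
      linarith
    calc _ ≤ Real.exp (‖z‖ ^ 2 / 6) * x ^ K * 2 := by gcongr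
      _ = _ := by ring

/-- A bound for the remainder without restriction on `τ`: where the Taylor formula
is not available, `g` and the terms of the sum are bounded separately. -/
lemma norm_g_sub_sum_le (K : ℕ) (τ z : ℂ) :
    ‖g τ z - ∑ k ∈ Finset.range (K + 1), P k z * τ ^ k‖
      ≤ (8 * (‖z‖ + 1) * ‖τ‖) ^ (K + 1) * ((K + 2) * Real.exp (‖z‖ ^ 2 / 6) + ‖g τ z‖) := by
  set y := 8 * (‖z‖ + 1) * ‖τ‖ with hy
  have hy0 : 0 ≤ y := by positivity
  have hE := Real.exp_pos (‖z‖ ^ 2 / 6)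
  have hK : (0 : ℝ) ≤ K := K.cast_nonneg
  rcases le_or_gt y 1 with h | h
  · refine (norm_g_sub_sum_le_of_small (K + 1) z h).trans ?_
    have h1 : (4 * (‖z‖ + 1) * ‖τ‖) ^ (K + 1) ≤ y ^ (K + 1) := by
      rw [hy]
      gcongr
      norm_num
    calc _ ≤ 2 * Real.exp (‖z‖ ^ 2 / 6) * y ^ (K + 1) := by gcongr
      _ = y ^ (K + 1) * (2 * Real.exp (‖z‖ ^ 2 / 6)) := by ring
      _ ≤ _ := by
        gcongr
        have := norm_nonneg (g τ z)
        nlinarith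
  · refine (norm_sub_le _ _).trans ?_
    have h1 : ‖g τ z‖ ≤ y ^ (K + 1) * ‖g τ z‖ :=
      le_mul_of_one_le_left (norm_nonneg _) (one_le_pow₀ h.le)
    have h2 : ‖∑ k ∈ Finset.range (K + 1), P k z * τ ^ k‖
        ≤ (K + 1) * (y ^ (K + 1) * Real.exp (‖z‖ ^ 2 / 6)) := by
      refine (norm_sum_le_of_le _ (f := fun k => P k z * τ ^ k)
        (n := fun _ => y ^ (K + 1) * Real.exp (‖z‖ ^ 2 / 6)) fun k hk => ?_).trans ?_
      · rw [norm_mul, norm_pow]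
        calc _ ≤ Real.exp (‖z‖ ^ 2 / 6) * (4 * (‖z‖ + 1)) ^ k * ‖τ‖ ^ k := by
              gcongr
              exact norm_P_le _ _
          _ = Real.exp (‖z‖ ^ 2 / 6) * (4 * (‖z‖ + 1) * ‖τ‖) ^ k := by
              rw [mul_assoc, ← mul_pow]
          _ ≤ Real.exp (‖z‖ ^ 2 / 6) * y ^ k := by
              rw [hy]
              gcongr
              norm_num
          _ ≤ Real.exp (‖z‖ ^ 2 / 6) * y ^ (K + 1) := by
              gcongr
              · exact h.le
              · exact (Finset.mem_range.mp hk).le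
          _ = _ := mul_comm _ _
      · rw [Finset.sum_const, Finset.card_range, nsmul_eq_mul]
        push_cast
        exact le_rfl
    have h3 : 0 ≤ y ^ (K + 1) * Real.exp (‖z‖ ^ 2 / 6) := by positivity
    linarith

lemma measurable_g (τ : ℂ) : Measurable (g τ) := by
  by_cases h : τ = 0
  · have : g τ = fun _ => 1 := by
      funext z
      rw [g, if_pos h]
    rw [this]
    exact measurable_const
  · have : g τ = fun z => exp (-(I / (8 * τ ^ 2)) * log (1 + 2 * I * τ * z) - z / (4 * τ)
        + I * z ^ 2 / 4) := by
      funext z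
      rw [g, if_neg h]
    rw [this]
    fun_prop

/-- Each Taylor coefficient is a pointwise limit of measurable functions, namely of the quotients
of the preceding remainder by `τ ^ k`. -/
lemma measurable_P (k : ℕ) : Measurable (P k) := by
  induction k using Nat.strong_induction_on with
  | _ k ih =>
    have hτ0 : ∀ n : ℕ, ((n : ℂ) + 1)⁻¹ ≠ 0 := fun n => inv_ne_zero (Nat.cast_add_one_ne_zero n)
    refine measurable_of_tendsto_metrizable (f := fun (n : ℕ) z =>
      (g ((n : ℂ) + 1)⁻¹ z - ∑ j ∈ Finset.range k, P j z * (((n : ℂ) + 1)⁻¹) ^ j)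
        / (((n : ℂ) + 1)⁻¹) ^ k) (fun n => ?_) ?_
    · refine ((measurable_g _).sub (Finset.measurable_fun_sum _ fun j hj => ?_)).div_const _
      exact (ih j (Finset.mem_range.mp hj)).mul_const _
    · rw [tendsto_pi_nhds]
      intro z
      have hlim : Filter.Tendsto (fun n : ℕ => ‖((n : ℂ) + 1)⁻¹‖) Filter.atTop (nhds 0) := by
        have := tendsto_one_div_add_atTop_nhds_zero_nat (𝕜 := ℂ)
        simpa using this.norm
      have hsmall : ∀ᶠ n : ℕ in Filter.atTop, 8 * (‖z‖ + 1) * ‖((n : ℂ) + 1)⁻¹‖ ≤ 1 := by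
        have := hlim.const_mul (8 * (‖z‖ + 1))
        rw [mul_zero] at this
        exact this.eventually_le_const one_pos
      rw [tendsto_iff_norm_sub_tendsto_zero]
      apply squeeze_zero' (g := fun n : ℕ =>
        2 * Real.exp (‖z‖ ^ 2 / 6) * (4 * (‖z‖ + 1)) ^ (k + 1) * ‖((n : ℂ) + 1)⁻¹‖)
        (Filter.Eventually.of_forall fun n => norm_nonneg _)
      · filter_upwards [hsmall] with n hn
        have h1 := norm_g_sub_sum_le_of_small (k + 1) z hn
        have hpos : 0 < ‖((n : ℂ) + 1)⁻¹‖ := norm_pos_iff.mpr (hτ0 n)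
        rw [Finset.sum_range_succ] at h1
        set τ := ((n : ℂ) + 1)⁻¹
        have h2 : (g τ z - ∑ j ∈ Finset.range k, P j z * τ ^ j) / τ ^ k - P k z
            = (g τ z - (∑ j ∈ Finset.range k, P j z * τ ^ j + P k z * τ ^ k)) / τ ^ k := by
          have := pow_ne_zero k (hτ0 n)
          rw [← sub_sub, sub_div _ (P k z * τ ^ k), mul_div_cancel_right₀ _ this]
        rw [h2, norm_div, norm_pow, div_le_iff₀ (by positivity)]
        refine h1.trans (le_of_eq ?_)
        rw [mul_pow _ ‖τ‖, pow_succ ‖τ‖]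
        ring
      · simpa using hlim.const_mul (2 * Real.exp (‖z‖ ^ 2 / 6) * (4 * (‖z‖ + 1)) ^ (k + 1))

/-! ### The phase function near the saddle point -/

/-- The phase `ζ² + 2ζ - 2 log (1 + ζ)`. With `x = ξ (1 + ζ)` and `s = 2πiξ²`, the product
`x^{-s} e^{πix²}` equals `ξ^{-s} e^{πiξ²} e^{πiξ² phase ζ}`. -/
noncomputable def phase (ζ : ℂ) : ℂ := ζ ^ 2 + 2 * ζ - 2 * log (1 + ζ)

lemma hasDerivAt_phase {ζ : ℂ} (hζ : 1 + ζ ∈ slitPlane) :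
    HasDerivAt phase (2 * ζ * (1 + 1 / (1 + ζ))) ζ := by
  have h0 : 1 + ζ ≠ 0 := slitPlane_ne_zero hζ
  have h1 : HasDerivAt (fun z : ℂ => 1 + z) 1 ζ := (hasDerivAt_id ζ).const_add 1
  have h := (((hasDerivAt_id ζ).pow 2).add ((hasDerivAt_id ζ).const_mul 2)).sub
    ((h1.clog hζ).const_mul 2)
  refine h.congr_deriv ?_
  simp
  field_simp
  ring

lemma re_exp_mul_log (b : ℝ) (x : ℂ) :
    (exp (-(2 * b : ℝ) * I) * log x).re
      = Real.cos (2 * b) * Real.log ‖x‖ + Real.sin (2 * b) * arg x := by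
  rw [← ofReal_neg, mul_re, exp_ofReal_mul_I_re, exp_ofReal_mul_I_im, log_re, log_im, Real.cos_neg,
    Real.sin_neg]
  ring

lemma exp_neg_two_mul_mul (b r : ℝ) :
    exp (-(2 * b : ℝ) * I) * (r * exp (b * I)) ^ 2 = r ^ 2 := by
  rw [mul_pow, ← exp_nat_mul, mul_left_comm, ← exp_add]
  push_cast
  rw [show -(2 * b : ℂ) * I + 2 * (b * I) = 0 by ring, exp_zero, mul_one]

lemma re_exp_neg_two_mul_mul (b r : ℝ) :
    (exp (-(2 * b : ℝ) * I) * (r * exp (b * I))).re = r * Real.cos b := by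
  have : exp (-(2 * b : ℝ) * I) * (r * exp (b * I)) = r * exp ((-b : ℝ) * I) := by
    rw [mul_left_comm, ← exp_add]
    congr 2
    push_cast
    ring
  rw [this, re_ofReal_mul, exp_ofReal_mul_I_re, Real.cos_neg]

lemma re_exp_mul_phase (b r : ℝ) :
    (exp (-(2 * b : ℝ) * I) * phase (r * exp (b * I))).re
      = r ^ 2 + 2 * r * Real.cos b - 2 * (Real.cos (2 * b) * Real.log ‖1 + r * exp (b * I)‖
          + Real.sin (2 * b) * arg (1 + r * exp (b * I))) := by
  have h : exp (-(2 * b : ℝ) * I) * phase (r * exp (b * I))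
      = exp (-(2 * b : ℝ) * I) * (r * exp (b * I)) ^ 2
        + ((2 : ℝ) : ℂ) * (exp (-(2 * b : ℝ) * I) * (r * exp (b * I)))
        - ((2 : ℝ) : ℂ) * (exp (-(2 * b : ℝ) * I) * log (1 + r * exp (b * I))) := by
    rw [phase]
    push_cast
    ring
  rw [h, sub_re, add_re, exp_neg_two_mul_mul, re_ofReal_mul, re_ofReal_mul, re_exp_mul_log,
    re_exp_neg_two_mul_mul, ← ofReal_pow, ofReal_re]
  ring

lemma one_add_re (b r : ℝ) : (1 + r * exp (b * I)).re = 1 + r * Real.cos b := by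
  rw [add_re, re_ofReal_mul, exp_ofReal_mul_I_re, one_re]

lemma one_add_im (b r : ℝ) : (1 + r * exp (b * I)).im = r * Real.sin b := by
  rw [add_im, im_ofReal_mul, exp_ofReal_mul_I_im, one_im, zero_add]

/-- As long as the ray from `1` stays in the right half-plane, the derivative of the phase along it
shows that the quadratic term alone is a lower bound. -/
lemma sq_le_re_phase_of_nonneg {b r : ℝ} (hb : 0 < Real.sin b) (h : 0 ≤ 1 + r * Real.cos b) :
    r ^ 2 ≤ (exp (-(2 * b : ℝ) * I) * phase (r * exp (b * I))).re := by
  set e : ℂ := exp (-(2 * b : ℝ) * I) with he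
  set ζ : ℂ := r * exp (b * I) with hζ
  have hre : ∀ t ∈ Set.Icc (0 : ℝ) 1, 0 ≤ (1 + t * ζ).re := by
    intro t ht
    have : (1 + t * ζ).re = (1 - t) + t * (1 + r * Real.cos b) := by
      rw [add_re, re_ofReal_mul, hζ, re_ofReal_mul, exp_ofReal_mul_I_re, one_re]
      ring
    rw [this]
    have := mul_nonneg ht.1 h
    linarith [ht.2]
  have hslit : ∀ t ∈ Set.Icc (0 : ℝ) 1, 1 + t * ζ ∈ slitPlane := by
    intro t ht
    rw [mem_slitPlane_iff]
    rcases eq_or_ne (t * r) 0 with h0 | h0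
    · left
      have : (t : ℂ) * ζ = ((t * r : ℝ) : ℂ) * exp (b * I) := by
        rw [hζ]
        push_cast
        ring
      rw [this, h0]
      simp
    · right
      have : (1 + t * ζ).im = t * r * Real.sin b := by
        rw [add_im, im_ofReal_mul, hζ, im_ofReal_mul, exp_ofReal_mul_I_im, one_im]
        ring
      rw [this]
      exact mul_ne_zero h0 hb.ne'
  have hder : ∀ t ∈ Set.Icc (0 : ℝ) 1, HasDerivAt
      (fun t : ℝ => (e * (t * ζ - log (1 + t * ζ))).re) ((e * (ζ - ζ / (1 + t * ζ))).re) t := by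
    intro t ht
    have h1 : HasDerivAt (fun t : ℝ => (t : ℂ) * ζ) ζ t := by
      simpa using (hasDerivAt_id t).ofReal_comp.mul_const ζ
    have h2 := (h1.sub ((h1.const_add 1).clog_real (hslit t ht))).const_mul e
    exact (reCLM.hasFDerivAt.comp_hasDerivAt t h2)
  have hmono : MonotoneOn (fun t : ℝ => (e * (t * ζ - log (1 + t * ζ))).re) (Set.Icc 0 1) := by
    apply monotoneOn_of_deriv_nonneg (convex_Icc 0 1)
    · exact fun t ht => (hder t ht).continuousAt.continuousWithinAt
    · exact fun t ht => (hder t (interior_subset ht)).differentiableAt.differentiableWithinAt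
    · intro t ht
      have ht' := interior_subset ht
      rw [(hder t ht').deriv]
      have h0 := slitPlane_ne_zero (hslit t ht')
      have : e * (ζ - ζ / (1 + t * ζ)) = ((t * r ^ 2 : ℝ) : ℂ) * (1 + t * ζ)⁻¹ := by
        have h3 : e * ζ ^ 2 = r ^ 2 := exp_neg_two_mul_mul b r
        push_cast
        rw [← h3]
        rw [eq_mul_inv_iff_mul_eq₀ h0, mul_assoc, sub_mul, div_mul_cancel₀ _ h0]
        ring
      rw [this, re_ofReal_mul, inv_re]
      have := hre t ht'
      have := normSq_nonneg (1 + t * ζ)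
      have := ht'.1
      positivity
  have h01 := hmono (Set.left_mem_Icc.mpr zero_le_one) (Set.right_mem_Icc.mpr zero_le_one)
    zero_le_one
  have h3 : e * phase ζ = ((r ^ 2 : ℝ) : ℂ) + ((2 : ℝ) : ℂ) * (e * (ζ - log (1 + ζ))) := by
    have h3 : e * ζ ^ 2 = r ^ 2 := exp_neg_two_mul_mul b r
    push_cast
    rw [← h3, phase]
    ring
  rw [h3, add_re, re_ofReal_mul, ofReal_re]
  simp only [ofReal_zero, zero_mul, add_zero, log_one, sub_zero, mul_zero, zero_re, ofReal_one,
    one_mul] at h01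
  linarith

/-- The elementary inequality behind `le_re_phase_of_neg`, with `R = ‖1 + ζ‖`, `r = ‖ζ‖`,
`S = sin b`, `c = -cos b` and `φ = arg (1 + ζ)`. -/
lemma phase_inequality {R r S c φ : ℝ} (hR0 : 0 < R) (hr : 0 ≤ r) (hS : 0 < S)
    (hSC : S ^ 2 + c ^ 2 = 1) (hn : R ^ 2 = r ^ 2 - 2 * r * c + 1) (hrc : 1 < r * c)
    (hφ : Real.pi / 2 ≤ φ) :
    S * r ^ 2 / 20 ≤ r ^ 2 - 2 * r * c - 2 * (1 - 2 * S ^ 2) * Real.log R + 4 * S * c * φ := by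
  have hc0 : 0 < c := by
    by_contra hneg
    have := mul_nonneg hr (by linarith : 0 ≤ -c)
    linarith
  have hS1 : S ≤ 1 := by nlinarith
  have hc1 : c ≤ 1 := by nlinarith
  have hargSC : 6 * (S * c) ≤ 4 * S * c * φ := by
    have := Real.pi_gt_three
    have h0 : 0 ≤ S * c * (φ - 3 / 2) := mul_nonneg (by positivity) (by linarith)
    linarith
  have hlog : Real.log R ≤ R - 1 := Real.log_le_sub_one_of_pos hR0
  rcases le_or_gt 1 R with hR | hR
  · have hlog0 : 0 ≤ Real.log R := Real.log_nonneg hR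
    have h1 : 0 ≤ S ^ 2 * Real.log R := by positivity
    have h2 : (R - 1) ^ 2 + 6 * (S * c)
        ≤ r ^ 2 - 2 * r * c - 2 * (1 - 2 * S ^ 2) * Real.log R + 4 * S * c * φ := by
      linarith
    refine le_trans ?_ h2
    rcases le_or_gt r 4 with h4 | h4
    · have h5 : 1 ≤ 4 * c := by nlinarith
      have h6 : S * 1 ≤ S * (4 * c) := mul_le_mul_of_nonneg_left h5 hS.le
      have h7 : S * r ^ 2 ≤ S * 16 := mul_le_mul_of_nonneg_left (by nlinarith) hS.le
      linarith [sq_nonneg (R - 1)]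
    · have h5 : r - 1 ≤ R := by
        apply abs_le_of_sq_le_sq' _ hR0.le |>.2
        nlinarith
      have h6 : (r - 2) ^ 2 ≤ (R - 1) ^ 2 := by
        apply pow_le_pow_left₀ <;> linarith
      have h7 : S * r ^ 2 ≤ 1 * r ^ 2 := mul_le_mul_of_nonneg_right hS1 (by positivity)
      have h8 : 0 ≤ S * c := by positivity
      have h9 : 0 ≤ (r - 4) * (3 * r - 4) := mul_nonneg (by linarith) (by linarith)
      linarith [sq_nonneg r]
  · have hSR : S ≤ R := by
      apply abs_le_of_sq_le_sq' _ hR0.le |>.2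
      linarith [sq_nonneg (r - c)]
    have hinv : -Real.log R * R ≤ 1 := by
      have := Real.log_le_sub_one_of_pos (inv_pos.mpr hR0)
      rw [Real.log_inv] at this
      have h9 : -Real.log R * R ≤ (R⁻¹ - 1) * R := mul_le_mul_of_nonneg_right this hR0.le
      rw [sub_mul, inv_mul_cancel₀ hR0.ne'] at h9
      linarith
    have hSL : S * -Real.log R ≤ 1 := by
      have := mul_le_mul_of_nonneg_right hSR (by linarith : 0 ≤ -Real.log R)
      linarith
    have hr2c : r < 2 * c := by nlinarith
    have hc3 : 0.7 ≤ c := by nlinarith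
    have h1 : 2 * Real.log R ≤ R ^ 2 - 1 := by
      have := Real.log_le_sub_one_of_pos (pow_pos hR0 2)
      rw [Real.log_pow] at this
      exact_mod_cast this
    have h2 : S * (6 * c - 4)
        ≤ r ^ 2 - 2 * r * c - 2 * (1 - 2 * S ^ 2) * Real.log R + 4 * S * c * φ := by
      have : S * (S * -Real.log R) ≤ S * 1 := mul_le_mul_of_nonneg_left hSL hS.le
      linarith
    refine le_trans ?_ h2
    have h3 : S * r ^ 2 ≤ S * 4 := mul_le_mul_of_nonneg_left (by nlinarith) hS.le
    have h4 : S * 0.2 ≤ S * (6 * c - 4) := mul_le_mul_of_nonneg_left (by linarith) hS.le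
    linarith

/-- Beyond the imaginary axis the logarithm is written out by modulus and argument; the term
`arg (1 + ζ) ≥ π/2` outweighs the possibly negative `log ‖1 + ζ‖`. -/
lemma le_re_phase_of_neg {b r : ℝ} (hb : 0 < Real.sin b) (hr : 0 ≤ r)
    (h : 1 + r * Real.cos b < 0) :
    Real.sin b * r ^ 2 / 20 ≤ (exp (-(2 * b : ℝ) * I) * phase (r * exp (b * I))).re := by
  rw [re_exp_mul_phase]
  set x : ℂ := 1 + r * exp (b * I) with hx
  have hxre : x.re < 0 := by rw [hx, one_add_re]; exact h
  have hxim : 0 ≤ x.im := by rw [hx, one_add_im]; positivity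
  have harg : Real.pi / 2 ≤ arg x := by
    by_contra hlt
    have h1 : |arg x| ≤ Real.pi / 2 := by
      rw [abs_of_nonneg (arg_nonneg_iff.mpr hxim)]
      linarith
    have := abs_arg_le_pi_div_two_iff.mp h1
    linarith
  have hn : ‖x‖ ^ 2 = r ^ 2 - 2 * r * -Real.cos b + 1 := by
    rw [Complex.sq_norm, normSq_apply, hx, one_add_re, one_add_im]
    linear_combination r ^ 2 * Real.sin_sq_add_cos_sq b
  have hn0 : 0 < ‖x‖ := norm_pos_iff.mpr fun h0 => by rw [h0] at hxre; simp at hxre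
  have hSC : Real.sin b ^ 2 + (-Real.cos b) ^ 2 = 1 := by
    rw [neg_sq]
    exact Real.sin_sq_add_cos_sq b
  refine (phase_inequality hn0 hr hb hSC hn (by linarith) harg).trans (le_of_eq ?_)
  rw [Real.cos_two_mul, Real.sin_two_mul]
  linear_combination (4 * Real.log ‖x‖) * hSC

lemma conj_phase {ζ : ℂ} (h : 1 + ζ ∈ slitPlane) :
    phase (starRingEnd ℂ ζ) = starRingEnd ℂ (phase ζ) := by
  have : 1 + starRingEnd ℂ ζ = starRingEnd ℂ (1 + ζ) := by simp
  rw [phase, phase, this, log_conj _ (mem_slitPlane_iff_arg.mp h).1]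
  simp only [map_sub, map_add, map_mul, map_pow, map_ofNat]

/-- On the whole line through the saddle point in the direction of integration, `-Re` of the
exponent dominates a multiple of `r²`. -/
lemma le_re_phase {b : ℝ} (hb : 0 < Real.sin b) (r : ℝ) :
    Real.sin b * r ^ 2 / 20 ≤ (exp (-(2 * b : ℝ) * I) * phase (r * exp (b * I))).re := by
  rcases le_or_gt 0 (1 + r * Real.cos b) with h | h
  · refine le_trans ?_ (sq_le_re_phase_of_nonneg hb h)
    have := mul_le_mul_of_nonneg_right (Real.sin_le_one b) (sq_nonneg r)
    linarith [sq_nonneg r]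
  rcases le_or_gt 0 r with hr | hr
  · exact le_re_phase_of_neg hb hr h
  -- complex conjugation exchanges `(r, b)` with `(-r, π - b)`
  have h1 := le_re_phase_of_neg (b := Real.pi - b) (r := -r) (by rwa [Real.sin_pi_sub])
    (by linarith) (by rw [Real.cos_pi_sub]; linarith)
  have hslit : 1 + r * exp (b * I) ∈ slitPlane := by
    rw [mem_slitPlane_iff, one_add_im]
    exact Or.inr (mul_ne_zero hr.ne hb.ne')
  have e1 : ((-r : ℝ) : ℂ) * exp ((Real.pi - b : ℝ) * I) = starRingEnd ℂ (r * exp (b * I)) := by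
    rw [map_mul, ← exp_conj, map_mul, conj_ofReal, conj_ofReal, conj_I]
    push_cast
    rw [show ((Real.pi : ℂ) - b) * I = Real.pi * I + b * -I by ring, exp_add, exp_pi_mul_I]
    ring
  have e2 : exp (-(2 * (Real.pi - b) : ℝ) * I) = starRingEnd ℂ (exp (-(2 * b : ℝ) * I)) := by
    rw [← exp_conj, map_mul, map_neg, conj_ofReal, conj_I, exp_eq_exp_iff_exists_int]
    refine ⟨-1, ?_⟩
    push_cast
    ring
  rw [e1, e2, conj_phase hslit, ← map_mul, conj_re, Real.sin_pi_sub, neg_sq] at h1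
  exact h1

lemma im_exp_neg_mul_one_add (b : ℝ) (r η : ℝ) :
    (exp ((-b : ℝ) * I) * (1 + (r - η * I) * exp (b * I))).im = -(Real.sin b + η) := by
  have h : exp ((-b : ℝ) * I) * (1 + (r - η * I) * exp (b * I))
      = exp ((-b : ℝ) * I) + (r - η * I) := by
    have : exp ((-b : ℝ) * I) * exp (b * I) = 1 := by
      rw [← exp_add]
      push_cast
      rw [show -(b : ℂ) * I + b * I = 0 by ring, exp_zero]
    linear_combination (r - η * I) * this
  rw [h, add_im, exp_ofReal_mul_I_im, Real.sin_neg, sub_im, ofReal_im, im_ofReal_mul, I_im]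
  ring

lemma le_norm_one_add (b : ℝ) (r η : ℝ) :
    Real.sin b + η ≤ ‖1 + (r - η * I) * exp (b * I)‖ := by
  have h := (abs_le.mp (abs_im_le_norm (exp ((-b : ℝ) * I) * (1 + (r - η * I) * exp (b * I))))).1
  rw [im_exp_neg_mul_one_add, norm_mul, norm_exp_ofReal_mul_I, one_mul] at h
  linarith

lemma one_add_mem_slitPlane {b : ℝ} (hb : 0 < Real.sin b) (r : ℝ) {η : ℝ}
    (h : 0 < Real.sin b + η) : 1 + (r - η * I) * exp (b * I) ∈ slitPlane := by
  have him := im_exp_neg_mul_one_add b r η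
  set x := 1 + (r - η * I) * exp (b * I)
  rw [mem_slitPlane_iff]
  by_contra hcon
  push Not at hcon
  rw [mul_im, hcon.2, exp_ofReal_mul_I_im, Real.sin_neg] at him
  have := mul_nonneg hb.le (neg_nonneg.mpr hcon.1)
  linarith

/-- The bound of `le_re_phase` persists, up to a lower order term, on a line that is displaced by
`η`, as long as it stays away from the singularity `ζ = -1` of the logarithm. -/
lemma le_re_phase_displaced {b : ℝ} (hb : 0 < Real.sin b) (r : ℝ) {η : ℝ}
    (hη : Real.sin b / 2 ≤ Real.sin b + η) :
    Real.sin b * r ^ 2 / 20 - 6 / Real.sin b * (|r| + |η|) * |η|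
      ≤ (exp (-(2 * b : ℝ) * I) * phase ((r - η * I) * exp (b * I))).re := by
  have hpos : ∀ t ∈ Set.Icc (0 : ℝ) 1, Real.sin b / 2 ≤ Real.sin b + t * η := by
    intro t ht
    rcases le_or_gt 0 η with h0 | h0
    · have := mul_nonneg ht.1 h0
      linarith
    · have := mul_le_mul_of_nonpos_right ht.2 h0.le
      linarith
  have hder : ∀ t ∈ Set.Icc (0 : ℝ) 1, HasDerivWithinAt
      (fun t : ℝ => phase ((r - (t * η : ℝ) * I) * exp (b * I)))
      (2 * ((r - (t * η : ℝ) * I) * exp (b * I)) *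
        (1 + 1 / (1 + (r - (t * η : ℝ) * I) * exp (b * I))) * (-(η * I) * exp (b * I)))
      (Set.Icc 0 1) t := by
    intro t ht
    have h1 : HasDerivAt (fun t : ℝ => ((r : ℂ) - (t * η : ℝ) * I) * exp (b * I))
        (-(η * I) * exp (b * I)) t := by
      have h2 : HasDerivAt (fun t : ℝ => ((t * η : ℝ) : ℂ)) (η : ℂ) t := by
        simpa using ((hasDerivAt_id t).mul_const η).ofReal_comp
      exact ((h2.mul_const I).const_sub (r : ℂ)).mul_const _
    exact ((hasDerivAt_phase (one_add_mem_slitPlane hb r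
      (lt_of_lt_of_le (half_pos hb) (hpos t ht)))).comp t h1).hasDerivWithinAt
  have hbd : ∀ t ∈ Set.Ico (0 : ℝ) 1, ‖2 * ((r - (t * η : ℝ) * I) * exp (b * I)) *
        (1 + 1 / (1 + (r - (t * η : ℝ) * I) * exp (b * I))) * (-(η * I) * exp (b * I))‖
        ≤ 6 / Real.sin b * (|r| + |η|) * |η| := by
    intro t ht
    have h1 : Real.sin b / 2 ≤ ‖1 + (r - (t * η : ℝ) * I) * exp (b * I)‖ :=
      (hpos t ⟨ht.1, ht.2.le⟩).trans (le_norm_one_add b r (t * η))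
    have h2 : ‖1 + 1 / (1 + (r - (t * η : ℝ) * I) * exp (b * I))‖ ≤ 3 / Real.sin b := by
      refine (norm_add_le _ _).trans ?_
      rw [norm_one, norm_div, norm_one]
      have h3 : 1 / ‖1 + (r - (t * η : ℝ) * I) * exp (b * I)‖ ≤ 1 / (Real.sin b / 2) :=
        one_div_le_one_div_of_le (half_pos hb) h1
      have h4 : 1 ≤ 1 / Real.sin b := by
        rw [le_div_iff₀ hb, one_mul]
        exact Real.sin_le_one b
      have h5 : 1 / (Real.sin b / 2) = 2 * (1 / Real.sin b) := by field_simp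
      have h6 : 3 / Real.sin b = 3 * (1 / Real.sin b) := by ring
      linarith
    have h3 : ‖(r : ℂ) - (t * η : ℝ) * I‖ ≤ |r| + |η| := by
      refine (norm_sub_le _ _).trans ?_
      simp only [norm_mul, norm_I, norm_real, Real.norm_eq_abs, mul_one]
      have : |t| * |η| ≤ 1 * |η| := mul_le_mul_of_nonneg_right
        (by rw [abs_of_nonneg ht.1]; exact ht.2.le) (abs_nonneg η)
      linarith
    rw [norm_mul, norm_mul, norm_mul, norm_mul, norm_mul, norm_exp_ofReal_mul_I, norm_neg,
      norm_mul, norm_I, norm_real, Real.norm_eq_abs, Complex.norm_ofNat, mul_one, mul_one, mul_one]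
    have h4 : 6 / Real.sin b * (|r| + |η|) * |η|
        = 2 * (|r| + |η|) * (3 / Real.sin b) * |η| := by ring
    rw [h4]
    gcongr
  have hmv := norm_image_sub_le_of_norm_deriv_le_segment_01' hder hbd
  simp only [one_mul, zero_mul, ofReal_zero, sub_zero] at hmv
  set e := exp (-(2 * b : ℝ) * I) with he
  have hen : ‖e‖ = 1 := by rw [he, ← ofReal_neg, norm_exp_ofReal_mul_I]
  have h1 := le_re_phase hb r
  have h2 : ‖e * (phase ((r - η * I) * exp (b * I)) - phase (r * exp (b * I)))‖
      ≤ 6 / Real.sin b * (|r| + |η|) * |η| := by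
    rw [norm_mul, hen, one_mul]
    exact hmv
  have h3 := (abs_le.mp ((abs_re_le_norm _).trans h2)).1
  rw [mul_sub, sub_re] at h3
  linarith

/-- The logarithm of `ξ (1 + ζ)` splits, because `arg (1 + ζ)` lies in `(b - π, b)`. -/
lemma log_mul_one_add {ξ : ℂ} (hξ : ξ ≠ 0) {b : ℝ} (hb0 : 0 < b) (hbπ : b < Real.pi)
    (harg : arg ξ = Real.pi / 4 - b) (r : ℝ) {η : ℝ} (h : 0 < Real.sin b + η) :
    log (ξ * (1 + (r - η * I) * exp (b * I)))
      = log ξ + log (1 + (r - η * I) * exp (b * I)) := by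
  have hb := Real.sin_pos_of_pos_of_lt_pi hb0 hbπ
  have hx := one_add_mem_slitPlane hb r h
  have him := im_exp_neg_mul_one_add b r η
  set x := 1 + (r - η * I) * exp (b * I)
  have hx0 : x ≠ 0 := slitPlane_ne_zero hx
  have h1 : Real.sin (arg x - b) < 0 := by
    have h2 : exp ((-b : ℝ) * I) * x = (‖x‖ : ℂ) * exp ((arg x - b : ℝ) * I) := by
      conv_lhs => rw [← norm_mul_exp_arg_mul_I x]
      rw [mul_left_comm, ← exp_add]
      push_cast
      ring_nf
    rw [h2, im_ofReal_mul, exp_ofReal_mul_I_im] at him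
    by_contra hcon
    have := mul_nonneg (norm_nonneg x) (not_lt.mp hcon)
    linarith
  have h2 := neg_pi_lt_arg x
  have h3 := arg_le_pi x
  have hpi := Real.pi_pos
  apply log_mul hξ hx0
  rw [harg]
  constructor
  · by_contra hcon
    have : 0 ≤ Real.sin (arg x - b + 2 * Real.pi) :=
      Real.sin_nonneg_of_nonneg_of_le_pi (by linarith) (by linarith)
    rw [Real.sin_add_two_pi] at this
    linarith
  · by_contra hcon
    have : 0 ≤ Real.sin (arg x - b) :=
      Real.sin_nonneg_of_nonneg_of_le_pi (by linarith) (by linarith)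
    linarith

/-! ### Coordinates along the line of integration -/

/-- The coordinate of `q` transversal to the direction of integration, up to sign; `mu q` is the
coordinate along it. -/
noncomputable def transversal (q : ℂ) : ℝ := (q.im - q.re) / Real.sqrt 2

lemma mul_dir_sub_eq (q : ℂ) (u : ℝ) :
    u * dir - q = ((u + mu q : ℝ) + transversal q * I) * dir := by
  have h : q = -((mu q : ℝ) + transversal q * I) * dir := by
    have h2 : Real.sqrt 2 * Real.sqrt 2 = 2 := Real.mul_self_sqrt (by norm_num)
    have h0 : Real.sqrt 2 ≠ 0 := by positivity
    apply Complex.ext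
    · rw [mul_re, neg_re, neg_im, add_re, add_im, re_ofReal_mul, im_ofReal_mul, ofReal_re,
        ofReal_im, I_re, I_im, dir_re, dir_im, mu, transversal]
      field_simp
      ring
    · rw [mul_im, neg_re, neg_im, add_re, add_im, re_ofReal_mul, im_ofReal_mul, ofReal_re,
        ofReal_im, I_re, I_im, dir_re, dir_im, mu, transversal]
      field_simp
      ring
  conv_lhs => rw [h]
  push_cast
  ring

lemma norm_mul_dir_sub_sq (q : ℂ) (u : ℝ) :
    ‖u * dir - q‖ ^ 2 = (u + mu q) ^ 2 + transversal q ^ 2 := by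
  rw [mul_dir_sub_eq, norm_mul, norm_dir, mul_one, Complex.sq_norm, normSq_add_mul_I]

lemma norm_mul_dir_sub_le {q : ℂ} (hq : |transversal q| ≤ 1) (u : ℝ) :
    ‖u * dir - q‖ ≤ |u + mu q| + 1 := by
  rw [mul_dir_sub_eq, norm_mul, norm_dir, mul_one]
  refine (norm_add_le _ _).trans ?_
  rw [norm_mul, norm_I, norm_real, norm_real, Real.norm_eq_abs, Real.norm_eq_abs, mul_one]
  linarith

/-- The weight common to all the integrals `D k q`. -/
noncomputable def weight (q v : ℂ) : ℂ :=
  exp (Real.pi * I / 2 * (v - q) ^ 2) / (2 * cos (Real.pi * v / 2))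

lemma norm_exp_weight (q : ℂ) (u : ℝ) :
    ‖exp (Real.pi * I / 2 * (u * dir - q) ^ 2)‖
      = Real.exp (-(Real.pi / 2) * ((u + mu q) ^ 2 - transversal q ^ 2)) := by
  rw [mul_dir_sub_eq, norm_exp, mul_pow, dir_sq]
  congr 1
  have : Real.pi * I / 2 * (((u + mu q : ℝ) + transversal q * I) ^ 2 * I)
      = ((-(Real.pi / 2) * ((u + mu q) ^ 2 - transversal q ^ 2) : ℝ) : ℂ)
        + ((-(Real.pi * (u + mu q) * transversal q) : ℝ) : ℂ) * I := by
    push_cast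
    linear_combination (Real.pi / 2 * ((u : ℂ) + mu q + transversal q * I) ^ 2
      - Real.pi / 2 * (transversal q : ℂ) ^ 2) * I_sq
  rw [this, add_re, re_ofReal_mul, ofReal_re, I_re, mul_zero, add_zero]

lemma two_mul_cos_ne_zero (u : ℝ) : 2 * cos (Real.pi * (u * dir) / 2) ≠ 0 :=
  norm_pos_iff.mp (lt_of_lt_of_le (by positivity) (exp_le_norm_two_mul_cos u))

/-- The decay of `1 / cos` in `u` is converted into decay in `mu q`, at the cost of a growing factor
that a Gaussian in `u + mu q` absorbs. -/
lemma norm_div_two_mul_cos_le (q w : ℂ) (u : ℝ) :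
    ‖w / (2 * cos (Real.pi * (u * dir) / 2))‖
      ≤ Real.exp (-(Real.pi / (2 * Real.sqrt 2)) * |mu q|)
        * (2 * ‖w‖ * Real.exp (Real.pi / (2 * Real.sqrt 2) * |u + mu q|)) := by
  set κ := Real.pi / (2 * Real.sqrt 2) with hκ
  have hκ0 : 0 ≤ κ := by positivity
  have h := exp_le_norm_two_mul_cos u
  rw [norm_div, div_le_iff₀ (norm_pos_iff.mpr (two_mul_cos_ne_zero u))]
  have h1 : |mu q| ≤ |u + mu q| + |u| := by
    have := abs_sub (u + mu q) u
    rwa [add_sub_cancel_left] at this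
  have h2 : (1 : ℝ) ≤ Real.exp (-κ * |mu q|) * Real.exp (κ * |u + mu q|) * Real.exp (κ * |u|) := by
    rw [← Real.exp_add, ← Real.exp_add]
    apply Real.one_le_exp
    have := mul_le_mul_of_nonneg_left h1 hκ0
    linarith
  calc ‖w‖ = ‖w‖ * 1 := (mul_one _).symm
    _ ≤ ‖w‖ * (Real.exp (-κ * |mu q|) * Real.exp (κ * |u + mu q|) * Real.exp (κ * |u|)) := by gcongr
    _ = Real.exp (-κ * |mu q|) * (2 * ‖w‖ * Real.exp (κ * |u + mu q|))
        * (Real.exp (κ * |u|) / 2) := by ring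
    _ ≤ _ := by gcongr

/-- The bound `e^{‖z‖²/6}` for the Taylor coefficients is absorbed by the weight. -/
lemma norm_exp_weight_mul_le {q : ℂ} (hq : |transversal q| ≤ 1) (u : ℝ) :
    ‖exp (Real.pi * I / 2 * (u * dir - q) ^ 2)‖
      * Real.exp (‖I * (Real.sqrt Real.pi : ℂ) * (u * dir - q)‖ ^ 2 / 6)
      ≤ Real.exp (-(Real.pi / 3) * (u + mu q) ^ 2 + 2 * Real.pi / 3) := by
  have h1 : ‖I * (Real.sqrt Real.pi : ℂ) * (u * dir - q)‖ ^ 2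
      = Real.pi * ((u + mu q) ^ 2 + transversal q ^ 2) := by
    rw [norm_mul, norm_mul, norm_I, one_mul, norm_real, mul_pow, norm_mul_dir_sub_sq,
      Real.norm_eq_abs, sq_abs, Real.sq_sqrt Real.pi_pos.le]
  rw [norm_exp_weight, h1, ← Real.exp_add]
  apply Real.exp_le_exp.mpr
  have h2 : transversal q ^ 2 ≤ 1 := (sq_le_one_iff_abs_le_one _).mpr hq
  have := mul_le_mul_of_nonneg_left h2 Real.pi_pos.le
  linarith

lemma norm_add_one_le {q : ℂ} (hq : |transversal q| ≤ 1) (u : ℝ) :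
    ‖I * (Real.sqrt Real.pi : ℂ) * (u * dir - q)‖ + 1
      ≤ Real.sqrt Real.pi * (|u + mu q| + 2) := by
  have h1 : 1 ≤ Real.sqrt Real.pi := Real.one_le_sqrt.mpr (by linarith [Real.pi_gt_three])
  have h2 := mul_le_mul_of_nonneg_left (norm_mul_dir_sub_le hq u) (Real.sqrt_nonneg Real.pi)
  rw [norm_mul, norm_mul, norm_I, one_mul, norm_real, Real.norm_of_nonneg (Real.sqrt_nonneg _)]
  linarith

lemma two_mul_add_two_le_exp {y : ℝ} (hy : 0 ≤ y) : 2 * (y + 2) ≤ Real.exp (y + 2) := by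
  have h1 := Real.add_one_le_exp (y + 1)
  have h2 := Real.add_one_le_exp (1 : ℝ)
  rw [show y + 2 = (y + 1) + 1 by ring, Real.exp_add (y + 1)]
  nlinarith [Real.exp_pos (y + 1)]

lemma measurable_weight_mul {q : ℂ} {f : ℂ → ℂ} (hf : Measurable f) :
    Measurable fun u : ℝ =>
      weight q (u * dir) * f (I * (Real.sqrt Real.pi : ℂ) * (u * dir - q)) := by
  unfold weight
  refine Measurable.mul ?_ (hf.comp (by fun_prop))
  exact Measurable.div (by fun_prop) (by fun_prop)

lemma integrable_weight_mul_P {q : ℂ} (hq : |transversal q| ≤ 1) (k : ℕ) :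
    Integrable fun u : ℝ =>
      weight q (u * dir) * P k (I * (Real.sqrt Real.pi : ℂ) * (u * dir - q)) := by
  set κ := Real.pi / (2 * Real.sqrt 2) with hκ
  have hpi := Real.pi_pos
  have hint := (((integrable_exp_quadratic_abs (by positivity : 0 < Real.pi / 3) (k + κ)
    (2 * k + 2 * Real.pi / 3)).comp_add_right (mu q)).const_mul
    (Real.exp (-κ * |mu q|) * (2 * (2 * Real.sqrt Real.pi) ^ k)))
  refine hint.mono' (measurable_weight_mul (measurable_P k)).aestronglyMeasurable
    (Filter.Eventually.of_forall fun u => ?_)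
  set z := I * (Real.sqrt Real.pi : ℂ) * (u * dir - q)
  set e := exp (Real.pi * I / 2 * (u * dir - q) ^ 2)
  set y := |u + mu q| with hy
  have h1 : ‖P k z‖ ≤ Real.exp (‖z‖ ^ 2 / 6) * ((2 * Real.sqrt Real.pi) ^ k
      * Real.exp (k * (y + 2))) := by
    refine (norm_P_le k z).trans ?_
    rw [Real.exp_nat_mul, ← mul_pow]
    have h3 := norm_add_one_le hq u
    have h4 := mul_le_mul_of_nonneg_left (two_mul_add_two_le_exp (abs_nonneg (u + mu q)))
      (Real.sqrt_nonneg Real.pi)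
    have h5 : 4 * (‖z‖ + 1) ≤ 2 * Real.sqrt Real.pi * Real.exp (y + 2) := by linarith
    exact mul_le_mul_of_nonneg_left (pow_le_pow_left₀ (by positivity) h5 k) (Real.exp_pos _).le
  have h2 := norm_exp_weight_mul_le hq u
  rw [weight, div_mul_eq_mul_div]
  refine (norm_div_two_mul_cos_le q _ u).trans ?_
  rw [mul_assoc (Real.exp (-κ * |mu q|))]
  refine mul_le_mul_of_nonneg_left ?_ (Real.exp_pos _).le
  rw [norm_mul]
  calc 2 * (‖e‖ * ‖P k z‖) * Real.exp (κ * y)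
      ≤ 2 * (‖e‖ * (Real.exp (‖z‖ ^ 2 / 6) * ((2 * Real.sqrt Real.pi) ^ k
          * Real.exp (k * (y + 2))))) * Real.exp (κ * y) := by gcongr
    _ = 2 * (2 * Real.sqrt Real.pi) ^ k * ((‖e‖ * Real.exp (‖z‖ ^ 2 / 6))
          * Real.exp (k * (y + 2)) * Real.exp (κ * y)) := by ring
    _ ≤ 2 * (2 * Real.sqrt Real.pi) ^ k * (Real.exp (-(Real.pi / 3) * (u + mu q) ^ 2
          + 2 * Real.pi / 3) * Real.exp (k * (y + 2)) * Real.exp (κ * y)) := by gcongr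
    _ = _ := by
      rw [← Real.exp_add, ← Real.exp_add]
      congr 2
      ring

/-- The value of the expansion parameter `τ` that belongs to `ξ`. -/
noncomputable def tau (ξ : ℂ) : ℂ := -1 / (4 * (Real.sqrt Real.pi : ℂ)) / ξ

lemma sqrt_pi_sq : (Real.sqrt Real.pi : ℂ) ^ 2 = Real.pi := by
  rw [← ofReal_pow, Real.sq_sqrt Real.pi_pos.le]

lemma sqrt_pi_ne_zero : (Real.sqrt Real.pi : ℂ) ≠ 0 :=
  ofReal_ne_zero.mpr (Real.sqrt_pos.mpr Real.pi_pos).ne'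

lemma exp_mul_g_eq {ξ : ℂ} (hξ : ξ ≠ 0) (ζ : ℂ) :
    exp (Real.pi * I / 2 * (2 * ξ * ζ) ^ 2) *
        g (tau ξ) (I * (Real.sqrt Real.pi : ℂ) * (2 * ξ * ζ))
      = exp (Real.pi * I * ξ ^ 2 * phase ζ) := by
  have h0 := sqrt_pi_ne_zero
  have h2 := sqrt_pi_sq
  have hτ : tau ξ ≠ 0 := by
    rw [tau]
    exact div_ne_zero (div_ne_zero (by norm_num) (mul_ne_zero (by norm_num) h0)) hξ
  have e1 : 2 * I * tau ξ * (I * (Real.sqrt Real.pi : ℂ) * (2 * ξ * ζ)) = ζ := by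
    rw [tau]
    field_simp
    linear_combination (-4 * ζ) * I_sq
  have e2 : I / (8 * tau ξ ^ 2) = 2 * Real.pi * I * ξ ^ 2 := by
    rw [tau, ← h2]
    field_simp
    norm_num
  have e3 : I * (Real.sqrt Real.pi : ℂ) * (2 * ξ * ζ) / (4 * tau ξ)
      = -(2 * Real.pi * I * ξ ^ 2 * ζ) := by
    rw [tau, ← h2]
    field_simp
  rw [g, if_neg hτ, e1, e2, e3, ← exp_add, phase]
  congr 1
  linear_combination (I * ξ ^ 2 * ζ ^ 2 * (Real.sqrt Real.pi : ℂ) ^ 2) * I_sq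
    - (I * ξ ^ 2 * ζ ^ 2) * h2

/-! ### The position of the line relative to the saddle point -/

/-- The angle `π/2 - arg s / 2` between the line of integration and the direction of `xi s`. -/
noncomputable def angle (s : ℂ) : ℝ := Real.pi / 2 - arg s / 2

lemma sin_angle (s : ℂ) : Real.sin (angle s) = Real.cos (arg s / 2) := Real.sin_pi_div_two_sub _

lemma norm_xi (s : ℂ) : ‖xi s‖ = Real.sqrt (‖s‖ / (2 * Real.pi)) := by
  rw [xi, norm_mul, norm_exp_ofReal_mul_I, mul_one, norm_real,
    Real.norm_of_nonneg (Real.sqrt_nonneg _)]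

lemma xi_eq (s : ℂ) : xi s = ‖xi s‖ * exp ((Real.pi / 4 - angle s : ℝ) * I) := by
  rw [norm_xi, xi, angle]
  ring_nf

lemma one_le_norm_xi {θ : ℝ} {s : ℂ} (hs : s ∈ Delta θ) : 1 ≤ ‖xi s‖ := by
  rw [norm_xi, Real.one_le_sqrt, le_div_iff₀ (by positivity), one_mul]
  exact hs.2.2

lemma sin_half_le_sin_angle {θ : ℝ} (hθ : 0 < θ) {s : ℂ} (hs : s ∈ Delta θ) :
    Real.sin (θ / 2) ≤ Real.sin (angle s) := by
  rw [sin_angle, ← Real.cos_abs (arg s / 2), ← Real.cos_pi_div_two_sub]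
  have h1 : |arg s / 2| ≤ Real.pi / 2 - θ / 2 :=
    abs_le.mpr ⟨by linarith [hs.1], by linarith [hs.2.1]⟩
  exact Real.cos_le_cos_of_nonneg_of_le_pi (abs_nonneg _) (by linarith [Real.pi_pos]) h1

lemma xi_re_sub_im (s : ℂ) :
    (xi s).re - (xi s).im = Real.sqrt 2 * ‖xi s‖ * Real.sin (angle s) := by
  rw [sin_angle, norm_xi, xi, re_ofReal_mul, im_ofReal_mul, exp_ofReal_mul_I_re,
    exp_ofReal_mul_I_im, Real.cos_sub, Real.sin_sub, Real.cos_pi_div_four, Real.sin_pi_div_four]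
  ring

lemma transversal_q (s : ℂ) :
    transversal (q s) = (2 * ell s + 1 - 2 * ((xi s).re - (xi s).im)) / Real.sqrt 2 := by
  rw [transversal, q]
  congr 1
  simp
  ring

lemma ell_le (s : ℂ) : (ell s : ℝ) ≤ (xi s).re - (xi s).im :=
  Nat.floor_le (xi_re_sub_im_nonneg s)

lemma lt_ell_add_one (s : ℂ) : (xi s).re - (xi s).im < ell s + 1 := Nat.lt_floor_add_one _

/-- The line of integration passes at bounded distance from the saddle point. -/
lemma abs_transversal_q_le (s : ℂ) : |transversal (q s)| ≤ 1 := by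
  have h2 : 1 ≤ Real.sqrt 2 := Real.one_le_sqrt.mpr (by norm_num)
  rw [transversal_q, abs_div, abs_of_pos (by linarith : 0 < Real.sqrt 2),
    div_le_iff₀ (by linarith), abs_le]
  have := ell_le s
  have := lt_ell_add_one s
  constructor <;> linarith

/-- Relative to its distance from the origin, the line of integration does not come closer to the
origin than half as far as the line through the saddle point. -/
lemma half_sin_le {s : ℂ} (hξ : 0 < ‖xi s‖) :
    Real.sin (angle s) / 2 ≤ Real.sin (angle s) + transversal (q s) / (2 * ‖xi s‖) := by
  have h0 : 0 < Real.sqrt 2 := by positivity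
  have h1 := xi_re_sub_im s
  have h3 : Real.sin (angle s) + transversal (q s) / (2 * ‖xi s‖)
      = (2 * ell s + 1) / (2 * Real.sqrt 2 * ‖xi s‖) := by
    rw [transversal_q, h1]
    field_simp
    ring
  rw [h3, le_div_iff₀ (by positivity)]
  have := lt_ell_add_one s
  have : (0 : ℝ) ≤ ell s := Nat.cast_nonneg _
  linarith

/-- The relative displacement `(x - ξ) / ξ` of the point `x = ℓ + 1/2 + v/2`, `v = u dir`. -/
lemma mul_dir_sub_q_eq {s : ℂ} (hξ : 0 < ‖xi s‖) (u : ℝ) :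
    u * dir - q s = 2 * xi s * (((-(u + mu (q s)) / (2 * ‖xi s‖) : ℝ)
      - (transversal (q s) / (2 * ‖xi s‖) : ℝ) * I) * exp (angle s * I)) := by
  have h1 : xi s * exp (angle s * I) = -(‖xi s‖ * dir) := by
    conv_lhs => rw [xi_eq]
    rw [mul_assoc, ← exp_add, dir, ← mul_neg]
    congr 1
    rw [← mul_neg_one, ← exp_pi_mul_I, ← exp_add]
    congr 1
    push_cast
    ring
  have h0 : (‖xi s‖ : ℂ) ≠ 0 := ofReal_ne_zero.mpr hξ.ne'
  rw [mul_dir_sub_eq]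
  set e := exp (angle s * I)
  push_cast
  field_simp
  linear_combination (((u : ℂ) + mu (q s)) + transversal (q s) * I) * h1

/-! ### The integrand around the saddle point -/

/-- The integrand on the line through `ℓ + 1/2`, in terms of the variable `v` and of `g`. -/
lemma integrand_eq {θ : ℝ} (hθ : 0 < θ) (hθπ : θ < Real.pi) {s : ℂ} (hs : s ∈ Delta θ) (u : ℝ) :
    integrand s (ell s + 1 / 2 + u * dir / 2)
      = 2 * ((-1) ^ ell s / (2 * I) * xi s ^ (-s) * exp (Real.pi * I * xi s ^ 2)) *
        (weight (q s) (u * dir) *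
          g (tau (xi s)) (I * (Real.sqrt Real.pi : ℂ) * (u * dir - q s))) := by
  have hr := one_le_norm_xi hs
  have hξ0 : 0 < ‖xi s‖ := by linarith
  have hξ : xi s ≠ 0 := norm_pos_iff.mp hξ0
  have hs0 : s ≠ 0 := by
    intro h
    have := hs.2.2
    rw [h, norm_zero] at this
    linarith [Real.pi_pos]
  have hsin : 0 < Real.sin (angle s) := lt_of_lt_of_le
    (Real.sin_pos_of_pos_of_lt_pi (by linarith) (by linarith)) (sin_half_le_sin_angle hθ hs)
  have hη : 0 < Real.sin (angle s) + transversal (q s) / (2 * ‖xi s‖) :=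
    lt_of_lt_of_le (half_pos hsin) (half_sin_le hξ0)
  set ζ : ℂ := ((-(u + mu (q s)) / (2 * ‖xi s‖) : ℝ)
      - (transversal (q s) / (2 * ‖xi s‖) : ℝ) * I) * exp (angle s * I) with hζ
  have hv : u * dir - q s = 2 * xi s * ζ := mul_dir_sub_q_eq hξ0 u
  have hx : (ell s + 1 / 2 + u * dir / 2 : ℂ) = xi s * (1 + ζ) := by
    rw [q] at hv
    linear_combination hv / 2
  have hlog : log (xi s * (1 + ζ)) = log (xi s) + log (1 + ζ) := by
    apply log_mul_one_add hξ _ _ _ _ hη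
    · rw [angle]
      linarith [hs.2.1]
    · rw [angle]
      linarith [hs.1]
    · rw [arg_xi hs0, angle]
      ring
  have h1ζ : 1 + ζ ≠ 0 := slitPlane_ne_zero (one_add_mem_slitPlane hsin _ hη)
  have hsξ : s = 2 * Real.pi * I * xi s ^ 2 := by
    rw [xi_sq]
    have : (Real.pi : ℂ) ≠ 0 := ofReal_ne_zero.mpr Real.pi_ne_zero
    field_simp
  rw [integrand, denominator_eq_cos, hx, weight, hv,
    div_mul_eq_mul_div (exp (Real.pi * I / 2 * (2 * xi s * ζ) ^ 2)), exp_mul_g_eq hξ,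
    cpow_def_of_ne_zero (mul_ne_zero hξ h1ζ), hlog, cpow_def_of_ne_zero hξ]
  have h2 : exp ((log (xi s) + log (1 + ζ)) * -s) * exp (Real.pi * I * (xi s * (1 + ζ)) ^ 2)
      = exp (log (xi s) * -s) * exp (Real.pi * I * xi s ^ 2)
        * exp (Real.pi * I * xi s ^ 2 * phase ζ) := by
    rw [← exp_add, ← exp_add, ← exp_add, phase]
    congr 1
    linear_combination (-log (1 + ζ)) * hsξ
  rw [h2]
  have hcos := two_mul_cos_ne_zero u
  set c := 2 * cos (Real.pi * (u * dir) / 2)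
  have h3 : ((-1 : ℂ) ^ ell s) * (-1) ^ ell s = 1 := by
    rw [← mul_pow]
    norm_num
  have h4 : ((-1 : ℂ) ^ ell s) ≠ 0 := pow_ne_zero _ (by norm_num)
  set w := (-1 : ℂ) ^ ell s
  field_simp
  linear_combination (-1 : ℂ) * h3

/-- The exponential decay of the whole integrand, which is also valid outside the disc of
convergence of the expansion. -/
lemma norm_exp_mul_g_le {θ : ℝ} (hθ : 0 < θ) (hθπ : θ < Real.pi) {s : ℂ} (hs : s ∈ Delta θ)
    (u : ℝ) :
    ‖exp (Real.pi * I / 2 * (u * dir - q s) ^ 2) *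
        g (tau (xi s)) (I * (Real.sqrt Real.pi : ℂ) * (u * dir - q s))‖
      ≤ Real.exp (-(Real.pi * Real.sin (θ / 2) / 80) * (u + mu (q s)) ^ 2
        + 2 * Real.pi / Real.sin (θ / 2) * (|u + mu (q s)| + 1)) := by
  have hr := one_le_norm_xi hs
  have hξ0 : 0 < ‖xi s‖ := by linarith
  have hξ : xi s ≠ 0 := norm_pos_iff.mp hξ0
  have hσ := Real.sin_pos_of_pos_of_lt_pi (by linarith : 0 < θ / 2) (by linarith)
  have hσle := sin_half_le_sin_angle hθ hs
  have hsin : 0 < Real.sin (angle s) := lt_of_lt_of_le hσ hσle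
  have key := le_re_phase_displaced hsin (-(u + mu (q s)) / (2 * ‖xi s‖)) (half_sin_le hξ0)
  rw [mul_dir_sub_q_eq hξ0 u, exp_mul_g_eq hξ, norm_exp]
  apply Real.exp_le_exp.mpr
  set y := u + mu (q s)
  set b := transversal (q s)
  set r := ‖xi s‖
  set S := Real.sin (angle s)
  set σ := Real.sin (θ / 2)
  set ζ : ℂ := ((-y / (2 * r) : ℝ) - (b / (2 * r) : ℝ) * I) * exp (angle s * I)
  have h1 : Real.pi * I * xi s ^ 2 * phase ζ
      = ((-(Real.pi * r ^ 2) : ℝ) : ℂ) * (exp (-(2 * angle s : ℝ) * I) * phase ζ) := by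
    have h2 : I * xi s ^ 2 = -(r ^ 2 * exp (-(2 * angle s : ℝ) * I)) := by
      conv_lhs => rw [xi_eq]
      rw [mul_pow, ← exp_nat_mul, mul_left_comm, ← mul_neg]
      congr 1
      have h3 : ((2 : ℕ) : ℂ) * ((Real.pi / 4 - angle s : ℝ) * I)
          = Real.pi / 2 * I + -(2 * angle s : ℝ) * I := by
        push_cast
        ring
      rw [h3, exp_add, exp_pi_div_two_mul_I]
      linear_combination exp (-(2 * angle s : ℝ) * I) * I_sq
    push_cast at h2 ⊢
    linear_combination (Real.pi * phase ζ) * h2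
  rw [h1, re_ofReal_mul]
  have hb1 : |b| ≤ 1 := abs_transversal_q_le s
  have hy0 := abs_nonneg y
  have hpi := Real.pi_pos
  have h2 : Real.pi * r ^ 2 * (S * (-y / (2 * r)) ^ 2 / 20
      - 6 / S * (|-y / (2 * r)| + |b / (2 * r)|) * |b / (2 * r)|)
      = Real.pi * S / 80 * y ^ 2 - 3 * Real.pi / 2 / S * ((|y| + |b|) * |b|) := by
    rw [abs_div, abs_div, abs_neg, abs_of_pos (by positivity : 0 < 2 * r)]
    field_simp
    ring
  have h3 : Real.pi * S / 80 * y ^ 2 - 3 * Real.pi / 2 / S * ((|y| + |b|) * |b|)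
      ≤ Real.pi * r ^ 2 * (exp (-(2 * angle s : ℝ) * I) * phase ζ).re := by
    rw [← h2]
    exact mul_le_mul_of_nonneg_left key (by positivity)
  have h4 : (|y| + |b|) * |b| ≤ |y| + 1 := by
    have := abs_nonneg b
    nlinarith
  have h5 : 3 * Real.pi / 2 / S * ((|y| + |b|) * |b|) ≤ 2 * Real.pi / σ * (|y| + 1) := by
    gcongr
    linarith
  have h6 : Real.pi * σ / 80 * y ^ 2 ≤ Real.pi * S / 80 * y ^ 2 := by gcongr
  linarith

/-! ### The remainder -/

/-- The remainder of the expansion of `g` after the term of order `K`. -/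
noncomputable def remainder (K : ℕ) (τ z : ℂ) : ℂ :=
  g τ z - ∑ k ∈ Finset.range (K + 1), P k z * τ ^ k

/-- The function of `y = u + mu q` that dominates the integrand of the error term. -/
noncomputable def majorant (K : ℕ) (σ y : ℝ) : ℝ :=
  2 * (K + 3) * Real.exp (-(Real.pi * σ / 80) * y ^ 2
    + ((K + 1) + 2 * Real.pi / σ + Real.pi / (2 * Real.sqrt 2)) * |y|
    + (2 * (K + 1) + 2 * Real.pi / σ))

lemma integrable_majorant (K : ℕ) {σ : ℝ} (hσ : 0 < σ) : Integrable (majorant K σ) :=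
  (integrable_exp_quadratic_abs (by have := Real.pi_pos; positivity) _ _).const_mul _

lemma norm_weight_mul_remainder_le {θ : ℝ} (hθ : 0 < θ) (hθπ : θ < Real.pi) (K : ℕ) {s : ℂ}
    (hs : s ∈ Delta θ) (u : ℝ) :
    ‖weight (q s) (u * dir) *
        remainder K (tau (xi s)) (I * (Real.sqrt Real.pi : ℂ) * (u * dir - q s))‖
      ≤ Real.exp (-(Real.pi / (2 * Real.sqrt 2)) * |mu (q s)|) / ‖xi s‖ ^ (K + 1)
        * majorant K (Real.sin (θ / 2)) (u + mu (q s)) := by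
  have hr := one_le_norm_xi hs
  have hξ0 : 0 < ‖xi s‖ := by linarith
  have hpi := Real.pi_pos
  have hσ := Real.sin_pos_of_pos_of_lt_pi (by linarith : 0 < θ / 2) (by linarith)
  have hσ1 := Real.sin_le_one (θ / 2)
  have hq := abs_transversal_q_le s
  have hg := norm_exp_mul_g_le hθ hθπ hs u
  have hP := norm_exp_weight_mul_le hq u
  have hrem := norm_g_sub_sum_le K (tau (xi s)) (I * (Real.sqrt Real.pi : ℂ) * (u * dir - q s))
  have hZ := norm_add_one_le hq u
  rw [weight, div_mul_eq_mul_div]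
  refine (norm_div_two_mul_cos_le (q s) _ u).trans ?_
  rw [div_mul_eq_mul_div (Real.exp _), mul_div_assoc (Real.exp _)]
  refine mul_le_mul_of_nonneg_left ?_ (Real.exp_pos _).le
  rw [remainder, norm_mul, majorant]
  rw [norm_mul] at hg
  set z := I * (Real.sqrt Real.pi : ℂ) * (u * dir - q s)
  set e := exp (Real.pi * I / 2 * (u * dir - q s) ^ 2)
  set y := u + mu (q s)
  set σ := Real.sin (θ / 2)
  set κ := Real.pi / (2 * Real.sqrt 2)
  set r := ‖xi s‖
  have hτ : ‖tau (xi s)‖ = 1 / (4 * Real.sqrt Real.pi * r) := by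
    rw [tau, norm_div, norm_div, norm_neg, norm_one, norm_mul, norm_real, Complex.norm_ofNat,
      Real.norm_of_nonneg (Real.sqrt_nonneg _), div_div]
  have hsp : 0 < Real.sqrt Real.pi := Real.sqrt_pos.mpr hpi
  have hT : (8 * (‖z‖ + 1) * ‖tau (xi s)‖) ^ (K + 1)
      ≤ Real.exp ((K + 1) * (|y| + 2)) / r ^ (K + 1) := by
    have h1 : 8 * (‖z‖ + 1) * ‖tau (xi s)‖ ≤ Real.exp (|y| + 2) / r := by
      calc _ ≤ 8 * (Real.sqrt Real.pi * (|y| + 2)) * ‖tau (xi s)‖ := by gcongr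
        _ = 2 * (|y| + 2) / r := by
          rw [hτ]
          field_simp
          norm_num
        _ ≤ _ := by
          gcongr
          exact two_mul_add_two_le_exp (abs_nonneg y)
    have h2 : Real.exp ((K + 1) * (|y| + 2)) = Real.exp (|y| + 2) ^ (K + 1) := by
      rw [← Real.exp_nat_mul]
      push_cast
      rfl
    rw [h2, ← div_pow]
    exact pow_le_pow_left₀ (by positivity) h1 _
  have hcommon : ‖e‖ * ((K + 2) * Real.exp (‖z‖ ^ 2 / 6) + ‖g (tau (xi s)) z‖)
      ≤ (K + 3) * Real.exp (-(Real.pi * σ / 80) * y ^ 2 + 2 * Real.pi / σ * (|y| + 1)) := by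
    have h1 : Real.exp (-(Real.pi / 3) * y ^ 2 + 2 * Real.pi / 3)
        ≤ Real.exp (-(Real.pi * σ / 80) * y ^ 2 + 2 * Real.pi / σ * (|y| + 1)) := by
      apply Real.exp_le_exp.mpr
      have h2 : Real.pi * σ / 80 * y ^ 2 ≤ Real.pi / 3 * y ^ 2 := by
        gcongr ?_ * _
        nlinarith
      have h3 : 2 * Real.pi / 3 * 1 ≤ 2 * Real.pi / σ * (|y| + 1) := by
        gcongr
        · linarith
        · linarith [abs_nonneg y]
      linarith
    have h4 := mul_le_mul_of_nonneg_left (hP.trans h1) (by positivity : (0 : ℝ) ≤ K + 2)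
    linarith
  calc 2 * (‖e‖ * ‖g (tau (xi s)) z - ∑ k ∈ Finset.range (K + 1), P k z * tau (xi s) ^ k‖)
        * Real.exp (κ * |y|)
      ≤ 2 * (‖e‖ * ((8 * (‖z‖ + 1) * ‖tau (xi s)‖) ^ (K + 1)
          * ((K + 2) * Real.exp (‖z‖ ^ 2 / 6) + ‖g (tau (xi s)) z‖))) * Real.exp (κ * |y|) := by
        gcongr
    _ = 2 * ((8 * (‖z‖ + 1) * ‖tau (xi s)‖) ^ (K + 1)
          * (‖e‖ * ((K + 2) * Real.exp (‖z‖ ^ 2 / 6) + ‖g (tau (xi s)) z‖)))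
          * Real.exp (κ * |y|) := by ring
    _ ≤ 2 * (Real.exp ((K + 1) * (|y| + 2)) / r ^ (K + 1)
          * ((K + 3) * Real.exp (-(Real.pi * σ / 80) * y ^ 2 + 2 * Real.pi / σ * (|y| + 1))))
          * Real.exp (κ * |y|) := by gcongr
    _ = 2 * (K + 3) * (Real.exp ((K + 1) * (|y| + 2))
          * Real.exp (-(Real.pi * σ / 80) * y ^ 2 + 2 * Real.pi / σ * (|y| + 1))
          * Real.exp (κ * |y|)) / r ^ (K + 1) := by ring
    _ = _ := by
        rw [← Real.exp_add, ← Real.exp_add]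
        congr 3
        ring

/-- The error term of the expansion. -/
noncomputable def error (K : ℕ) (s : ℂ) : ℂ :=
  lineIntegral 0 fun v => weight (q s) v *
    remainder K (tau (xi s)) (I * (Real.sqrt Real.pi : ℂ) * (v - q s))

lemma norm_error_le {θ : ℝ} (hθ : 0 < θ) (hθπ : θ < Real.pi) (K : ℕ) {s : ℂ}
    (hs : s ∈ Delta θ) :
    ‖error K s‖ ≤ (∫ y : ℝ, majorant K (Real.sin (θ / 2)) y) *
      (Real.exp (-(Real.pi / (2 * Real.sqrt 2)) * |mu (q s)|) / ‖xi s‖ ^ (K + 1)) := by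
  have hσ := Real.sin_pos_of_pos_of_lt_pi (by linarith : 0 < θ / 2) (by linarith)
  have hint := ((integrable_majorant K hσ).comp_add_right (mu (q s))).const_mul
    (Real.exp (-(Real.pi / (2 * Real.sqrt 2)) * |mu (q s)|) / ‖xi s‖ ^ (K + 1))
  rw [error, lineIntegral]
  refine (norm_integral_le_of_norm_le hint (Filter.Eventually.of_forall fun u => ?_)).trans ?_
  · simp only [zero_add]
    rw [norm_mul, norm_dir, mul_one]
    exact norm_weight_mul_remainder_le hθ hθπ K hs u
  · rw [integral_const_mul, integral_add_right_eq_self (majorant K (Real.sin (θ / 2))), mul_comm]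

lemma measurable_remainder (K : ℕ) (τ : ℂ) : Measurable (remainder K τ) :=
  (measurable_g τ).sub (Finset.measurable_fun_sum _ fun k _ => (measurable_P k).mul_const _)

lemma integrable_weight_mul_remainder {θ : ℝ} (hθ : 0 < θ) (hθπ : θ < Real.pi) (K : ℕ) {s : ℂ}
    (hs : s ∈ Delta θ) :
    Integrable fun u : ℝ => weight (q s) (u * dir) *
      remainder K (tau (xi s)) (I * (Real.sqrt Real.pi : ℂ) * (u * dir - q s)) := by
  have hσ := Real.sin_pos_of_pos_of_lt_pi (by linarith : 0 < θ / 2) (by linarith)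
  exact (((integrable_majorant K hσ).comp_add_right (mu (q s))).const_mul _).mono'
    (measurable_weight_mul (measurable_remainder K _)).aestronglyMeasurable
    (Filter.Eventually.of_forall fun u => norm_weight_mul_remainder_le hθ hθπ K hs u)

lemma lineIntegral_weight_mul_g {θ : ℝ} (hθ : 0 < θ) (hθπ : θ < Real.pi) (K : ℕ) {s : ℂ}
    (hs : s ∈ Delta θ) :
    (lineIntegral 0 fun v => weight (q s) v *
        g (tau (xi s)) (I * (Real.sqrt Real.pi : ℂ) * (v - q s)))
      = ∑ k ∈ Finset.range (K + 1), D k (q s) / xi s ^ k + error K s := by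
  have hD : ∀ k, D k (q s) / xi s ^ k = ∫ u : ℝ, tau (xi s) ^ k *
      (weight (q s) (u * dir) * P k (I * (Real.sqrt Real.pi : ℂ) * (u * dir - q s)) * dir) := by
    intro k
    rw [integral_const_mul, D, lineIntegral, tau, div_pow _ (xi s)]
    simp only [zero_add]
    rw [mul_div_right_comm]
    rfl
  have hP := fun k => ((integrable_weight_mul_P (abs_transversal_q_le s) k).mul_const dir).const_mul
    (tau (xi s) ^ k)
  have hE := (integrable_weight_mul_remainder hθ hθπ K hs).mul_const dir
  simp_rw [hD]
  rw [error, lineIntegral, lineIntegral, ← integral_finsetSum _ fun k _ => hP k]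
  simp only [zero_add]
  rw [← integral_add (integrable_finsetSum _ fun k _ => hP k) hE]
  refine integral_congr_ae (Filter.Eventually.of_forall fun u => ?_)
  simp only [remainder]
  have : ∀ z : ℂ, ∑ k ∈ Finset.range (K + 1),
        tau (xi s) ^ k * (weight (q s) (u * dir) * P k z * dir)
      = weight (q s) (u * dir) * (∑ k ∈ Finset.range (K + 1), P k z * tau (xi s) ^ k) * dir := by
    intro z
    rw [Finset.mul_sum, Finset.sum_mul]
    exact Finset.sum_congr rfl fun k _ => by ring
  rw [this]
  ring

/-- The substitution `x = ℓ + 1/2 + v/2`. -/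
lemma lineIntegral_integrand_eq {θ : ℝ} (hθ : 0 < θ) (hθπ : θ < Real.pi) {s : ℂ}
    (hs : s ∈ Delta θ) :
    lineIntegral (ell s + 1 / 2) (integrand s)
      = (-1) ^ ell s / (2 * I) * xi s ^ (-s) * exp (Real.pi * I * xi s ^ 2) *
        lineIntegral 0 fun v => weight (q s) v *
          g (tau (xi s)) (I * (Real.sqrt Real.pi : ℂ) * (v - q s)) := by
  set p := (-1) ^ ell s / (2 * I) * xi s ^ (-s) * exp (Real.pi * I * xi s ^ 2) with hp
  set F : ℝ → ℂ := fun u => weight (q s) (u * dir) *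
          g (tau (xi s)) (I * (Real.sqrt Real.pi : ℂ) * (u * dir - q s)) * dir with hF
  have h1 : ∀ u : ℝ, integrand s (ell s + 1 / 2 + u * dir) * dir = 2 * p * F (2 * u) := by
    intro u
    have h2 := integrand_eq hθ hθπ hs (2 * u)
    rw [show ((2 * u : ℝ) : ℂ) * dir / 2 = u * dir by push_cast; ring] at h2
    rw [h2, hF, hp]
    ring
  rw [lineIntegral, lineIntegral]
  simp_rw [h1]
  rw [integral_const_mul, Measure.integral_comp_mul_left F 2]
  simp only [zero_add]
  rw [abs_of_pos (by norm_num : (0 : ℝ) < 2⁻¹), real_smul]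
  push_cast
  ring

end RiemannAux

theorem theorem1 (θ : ℝ) (hθ₀ : 0 < θ) (hθπ : θ < Real.pi) (K : ℕ) (hK : 1 ≤ K) :
    ∃ C : ℝ, ∀ s ∈ RiemannAux.Delta θ, ∃ E : ℂ,
      ‖E‖ ≤ C * (Real.exp (-(Real.pi / (2 * Real.sqrt 2)) * |RiemannAux.mu (RiemannAux.q s)|) /
          ‖RiemannAux.xi s‖ ^ (K + 1)) ∧
      RiemannAux.R s =
        ∑ n ∈ Finset.Icc 1 (RiemannAux.ell s), (n : ℂ) ^ (-s) +
          (-1) ^ RiemannAux.ell s / (2 * Complex.I) * RiemannAux.xi s ^ (-s) *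
            Complex.exp (Real.pi * Complex.I * RiemannAux.xi s ^ 2) *
            (∑ k ∈ Finset.range (K + 1),
              RiemannAux.D k (RiemannAux.q s) / RiemannAux.xi s ^ k + E) := by
  refine ⟨∫ y : ℝ, RiemannAux.majorant K (Real.sin (θ / 2)) y, fun s hs =>
    ⟨RiemannAux.error K s, RiemannAux.norm_error_le hθ₀ hθπ K hs, ?_⟩⟩
  rw [RiemannAux.R_eq_sum_add_lineIntegral s (RiemannAux.ell s),
    RiemannAux.lineIntegral_integrand_eq hθ₀ hθπ hs,
    RiemannAux.lineIntegral_weight_mul_g hθ₀ hθπ K hs]
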